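/- Let $K$ be a field of characteristic $0$, complete with respect to a nonarchimedean absolute value $|\cdot|$, whose residue field has characteristic $p>0$, normalized by $|p|=p^{-1}$. Let $\mathfrak{o}_K=\{|x|\le 1\}$, $\mathfrak{m}_K=\{|x|<1\}$, and let $\Gamma^*$ be the divisible closure of $|K^*|$. For an interval $I\subseteq(0,1)$ which is aligned (every endpoint at which it is closed lies in $\Gamma^*$), let $A(I)=\{|t|\in I\}$ be the rigid analytic annulus over $K$ and $\mathcal{R}_I$ its ring of functions, that is, the Laurent series $f=\sum_{i\in\mathbb{Z}}c_it^i$ over $K$ convergent for $|t|\in I$, with the norms $|f|_\rho=\sup_i|c_i|\rho^i$ for $\rho\in I$. For $r\in(0,1)\cap\Gamma^*$, a $\nabla$-module on $A[r,1)$ is a coherent locally free sheaf $\mathcal{E}$ on $A[r,1)$ with a connection $\nabla:\mathcal{E}\to\mathcal{E}\otimes\Omega^1$; write $\frac{d}{dt}$ for the induced operator on sections. Let $n\ge 1$, $q=p^n$, and let $\sigma_K:K\to K$ be a continuous ring homomorphism with $\sigma_K(x)\equiv x^q \pmod{\mathfrak{m}_K}$ for $x\in\mathfrak{o}_K$. A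 Frobenius lift of order $n$ extending $\sigma_K$ is a map $\sigma:A[a,1)\to A[a^q,1)$, for some $a\in(0,1)\cap\Gamma^*$, which acts on constants through $\sigma_K$ and such that all coefficients of $\sigma^*(t)-t^q$ lie in $\mathfrak{m}_K$ (equivalently, $\sigma$ induces a map on the ring of Laurent series with coefficients in $\mathfrak{o}_K$ convergent on some annulus $A(b,1)$, which reduces modulo $\mathfrak{m}_K$ to the $q$-th power map). A Frobenius structure on $\mathcal{E}$ (with respect to $\sigma$) is an isomorphism of $\nabla$-modules $F:\sigma^*\mathcal{E}\to\mathcal{E}$ over $A[s,1)$ for some $s\in(0,1)\cap\Gamma^*$ sufficiently close to $1$. **Lemma.** If a $\nabla$-module $\mathcal{E}$ on $A[r,1)$ admits a Frobenius structure with respect to some Frobenius lift of some order $n\ge1$, then $\mathcal{E}$ is overconvergent: for every $\eta\in(0,1)$ there exists $s\in[r,1)$ such that for every closed aligned subinterval $I$ of $[s,1)$ and every section $\mathbf{v}\in\Gamma(\mathcal{E},A(I))$, the sequence $$\left\{\frac{1}{j!}\frac{d^j}{dt^j}\mathbf{v}\right\}_{j=0}^{\infty}$$ is $\eta$-null; that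 is, in terms of a basis of $\Gamma(\mathcal{E},A(I))$ over $\mathcal{R}_I$ (equivalently, with suitable coefficients in terms of any finite set of generators), the norms $|\cdot|_\rho$ of the coefficients of the $j$-th term, multiplied by $\eta^j$, converge to $0$ as $j\to\infty$, uniformly in $\rho\in I$. -/

import Mathlib

open Filter Topology

noncomputable section

namespace PadicAnnuli

universe u v

section Intervals

variable (K : Type u) [NormedField K]

/-- The divisible closure `Γ*` of the value group of `K`: the positive reals some positive power
of which is the absolute value of an element of `K`. -/
def divValueGroup : Set ℝ :=
  {x | 0 < x ∧ ∃ n : ℕ, 0 < n ∧ ∃ y : K, x ^ n = ‖y‖}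

variable {K}

theorem divValueGroup_pow {x : ℝ} (hx : x ∈ divValueGroup K) (m : ℕ) :
    x ^ m ∈ divValueGroup K := by
  obtain ⟨h0, n, hn, y, hy⟩ := hx
  refine ⟨pow_pos h0 m, n, hn, y ^ m, ?_⟩
  rw [norm_pow, ← hy, ← pow_mul, ← pow_mul, mul_comm]

variable (K)

/-- Aligned subintervals `I` of `(0,1)`: every endpoint at which `I` is closed lies in `Γ*`.
The annulus `A(I)` is `{|t| ∈ I}`. -/
structure AlignedInterval where
  carrier : Set ℝ
  nonempty : carrier.Nonempty
  ordConnected : carrier.OrdConnected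
  subset : carrier ⊆ Set.Ioo 0 1
  least_mem : ∀ x, IsLeast carrier x → x ∈ divValueGroup K
  greatest_mem : ∀ x, IsGreatest carrier x → x ∈ divValueGroup K

variable {K}

namespace AlignedInterval

instance : LE (AlignedInterval K) := ⟨fun I J => I.carrier ⊆ J.carrier⟩

theorem le_rfl' (I : AlignedInterval K) : I ≤ I := fun _ h => h

theorem le_trans' {I J L : AlignedInterval K} (h : I ≤ J) (h' : J ≤ L) : I ≤ L :=
  fun _ hr => h' (h hr)

theorem pos (I : AlignedInterval K) {r : ℝ} (hr : r ∈ I.carrier) : 0 < r := (I.subset hr).1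

/-- The interval `[a,1)`, for `a ∈ (0,1) ∩ Γ*`. -/
def ico (a : ℝ) (ha : a ∈ divValueGroup K) (h1 : a < 1) : AlignedInterval K where
  carrier := Set.Ico a 1
  nonempty := ⟨a, le_rfl, h1⟩
  ordConnected := Set.ordConnected_Ico
  subset := fun _ hx => ⟨lt_of_lt_of_le ha.1 hx.1, hx.2⟩
  least_mem := fun x hx => by
    have : x = a := le_antisymm (hx.2 ⟨le_rfl, h1⟩) hx.1.1
    rwa [this]
  greatest_mem := fun x hx => by
    exfalso
    obtain ⟨y, hy1, hy2⟩ := exists_between hx.1.2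
    exact absurd (hx.2 ⟨hx.1.1.trans hy1.le, hy2⟩) (not_le.mpr hy1)

end AlignedInterval

/-- The closed aligned subintervals `[c,d]` of an aligned interval `X`
(these index the closed annuli contained in `A(X)`). -/
structure ClosedSub (X : AlignedInterval K) extends AlignedInterval K where
  isCompact : IsCompact carrier
  le : toAlignedInterval ≤ X

end Intervals

section Ring

variable {K : Type u} [NormedField K]

/-- The ring `R_I` of rigid analytic functions on the annulus `A(I)`: the Laurent series
`∑ c_i t^i` with coefficients in `K` which converge for `|t| ∈ I`. -/
@[ext]
structure LaurentRing (I : AlignedInterval K) where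
  coeff : ℤ → K
  null' : ∀ r ∈ I.carrier, Tendsto (fun i => ‖coeff i‖ * r ^ i) cofinite (𝓝 0)

namespace LaurentRing

variable {I J : AlignedInterval K}

theorem coeff_injective : Function.Injective (coeff : LaurentRing I → ℤ → K) :=
  fun _ _ h => LaurentRing.ext h

/-- The Gauss norm `|∑ c_i t^i|_r = sup_i |c_i| r^i`. -/
def gaussNorm (r : ℝ) (f : LaurentRing I) : ℝ := ⨆ i : ℤ, ‖f.coeff i‖ * r ^ i

theorem bddAbove_of_null {w : ℤ → ℝ} (h : Tendsto w cofinite (𝓝 0)) :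
    BddAbove (Set.range w) := by
  have h1 : {i : ℤ | ¬ w i < 1}.Finite := h.eventually (gt_mem_nhds one_pos)
  obtain ⟨M, hM⟩ := (h1.image w).bddAbove
  refine ⟨max M 1, ?_⟩
  rintro _ ⟨i, rfl⟩
  by_cases hi : w i < 1
  · exact hi.le.trans (le_max_right _ _)
  · exact (hM ⟨i, hi, rfl⟩).trans (le_max_left _ _)

theorem le_gaussNorm (f : LaurentRing I) {r : ℝ} (hr : r ∈ I.carrier) (i : ℤ) :
    ‖f.coeff i‖ * r ^ i ≤ gaussNorm r f :=
  le_ciSup (bddAbove_of_null (f.null' r hr)) i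

theorem gaussNorm_nonneg (f : LaurentRing I) {r : ℝ} (hr : r ∈ I.carrier) :
    0 ≤ gaussNorm r f :=
  le_trans (mul_nonneg (norm_nonneg _) (zpow_nonneg (I.pos hr).le 0)) (le_gaussNorm f hr 0)

theorem gaussNorm_le (f : LaurentRing I) {r B : ℝ} (h : ∀ i, ‖f.coeff i‖ * r ^ i ≤ B) :
    gaussNorm r f ≤ B := ciSup_le h

instance : Zero (LaurentRing I) := ⟨⟨0, fun r _ => by simp⟩⟩

instance : Neg (LaurentRing I) := ⟨fun f => ⟨-f.coeff, fun r hr => by simpa using f.null' r hr⟩⟩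

instance : Add (LaurentRing I) := ⟨fun f g => ⟨f.coeff + g.coeff, fun r hr => by
  refine squeeze_zero (fun i => mul_nonneg (norm_nonneg _) (zpow_nonneg (I.pos hr).le i))
    (fun i => ?_) (by simpa using (f.null' r hr).add (g.null' r hr))
  have := zpow_nonneg (I.pos hr).le i
  have h2 := norm_add_le (f.coeff i) (g.coeff i)
  simp only [Pi.add_apply]
  nlinarith⟩⟩

/-- The Laurent monomial `c t^m`. -/
def monomial (m : ℤ) (c : K) : LaurentRing I :=
  ⟨Pi.single m c, fun r _ => by
    refine tendsto_const_nhds.congr' ?_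
    filter_upwards [(Set.finite_singleton m).compl_mem_cofinite] with i hi
    have : i ≠ m := by simpa using hi
    simp [Pi.single_eq_of_ne this]⟩

instance : One (LaurentRing I) := ⟨monomial 0 1⟩

@[simp] theorem coeff_zero (i : ℤ) : (0 : LaurentRing I).coeff i = 0 := rfl
@[simp] theorem coeff_add (f g : LaurentRing I) (i : ℤ) :
    (f + g).coeff i = f.coeff i + g.coeff i := rfl
@[simp] theorem coeff_neg (f : LaurentRing I) (i : ℤ) : (-f).coeff i = -f.coeff i := rfl
theorem coeff_monomial (m i : ℤ) (c : K) :
    (monomial m c : LaurentRing I).coeff i = if i = m then c else 0 := by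
  simp [monomial, Pi.single_apply]
theorem coeff_one (i : ℤ) : (1 : LaurentRing I).coeff i = if i = 0 then 1 else 0 :=
  coeff_monomial 0 i 1

theorem tendsto_mul_pairs (f g : LaurentRing I) {r : ℝ} (hr : r ∈ I.carrier) :
    Tendsto (fun x : ℤ × ℤ => (‖f.coeff x.1‖ * r ^ x.1) * (‖g.coeff x.2‖ * r ^ x.2))
      cofinite (𝓝 0) :=
  tendsto_mul_cofinite_nhds_zero (f.null' r hr) (g.null' r hr)

theorem weight_mul (f g : LaurentRing I) {r : ℝ} (hr : r ∈ I.carrier) (n i : ℤ) :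
    ‖f.coeff i * g.coeff (n - i)‖ * r ^ n =
      (‖f.coeff i‖ * r ^ i) * (‖g.coeff (n - i)‖ * r ^ (n - i)) := by
  have h : r ^ n = r ^ i * r ^ (n - i) := by
    rw [← zpow_add₀ (I.pos hr).ne']; congr 1; ring
  rw [norm_mul, h]; ring

theorem tendsto_zero_of_weight {α : Type*} {F : α → K} {c : ℝ} (hc : 0 < c)
    (h : Tendsto (fun x => ‖F x‖ * c) cofinite (𝓝 0)) : Tendsto F cofinite (𝓝 0) := by
  have h2 := h.mul_const c⁻¹
  rw [zero_mul] at h2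
  refine tendsto_zero_iff_norm_tendsto_zero.mpr (h2.congr fun x => ?_)
  rw [mul_assoc, mul_inv_cancel₀ hc.ne', mul_one]

theorem gaussNorm_one_le {r : ℝ} : gaussNorm r (1 : LaurentRing I) ≤ 1 := by
  refine gaussNorm_le _ fun i => ?_
  by_cases h : i = 0 <;> simp [coeff_one, h]

theorem tendsto_weights (f : LaurentRing J) {a b : ℝ} (ha : a ∈ J.carrier)
    (hb : b ∈ J.carrier) :
    Tendsto (fun i : ℤ => ‖f.coeff i‖ * (a ^ i + b ^ i)) cofinite (𝓝 0) := by
  have h := (f.null' a ha).add (f.null' b hb)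
  rw [zero_add] at h
  exact h.congr fun i => by ring

variable [IsUltrametricDist K]

/-- The derivative `d/dt`. -/
def deriv (f : LaurentRing I) : LaurentRing I :=
  ⟨fun i => ((i + 1 : ℤ) : K) * f.coeff (i + 1), fun r hr => by
    have hr0 := I.pos hr
    have h := ((f.null' r hr).comp
      (Function.Injective.tendsto_cofinite (add_left_injective (1 : ℤ)))).mul_const r⁻¹
    rw [zero_mul] at h
    refine squeeze_zero (fun i => mul_nonneg (norm_nonneg _) (zpow_nonneg hr0.le i))
      (fun i => ?_) h
    have h1 : ‖((i + 1 : ℤ) : K)‖ ≤ 1 := IsUltrametricDist.norm_intCast_le_one K _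
    have h2 : r ^ (i + 1) * r⁻¹ = r ^ i := by
      rw [zpow_add_one₀ hr0.ne', mul_assoc, mul_inv_cancel₀ hr0.ne', mul_one]
    simp only [Function.comp]
    rw [norm_mul, mul_assoc (‖f.coeff (i + 1)‖), h2]
    have := mul_nonneg (norm_nonneg (f.coeff (i + 1))) (zpow_nonneg hr0.le i)
    nlinarith⟩


/-- Restriction of functions to a smaller annulus. -/
def restrictFun (h : I ≤ J) (f : LaurentRing J) : LaurentRing I :=
  ⟨f.coeff, fun r hr => f.null' r (h hr)⟩

theorem tendsto_tsum_weight {α : Type*} (F : ℤ → α → K) {r : ℝ} (hr : 0 < r)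
    (h : ∀ ε > 0, ∀ᶠ n in cofinite, ∀ x, ‖F n x‖ * r ^ n ≤ ε) :
    Tendsto (fun n => ‖∑' x, F n x‖ * r ^ n) cofinite (𝓝 0) := by
  rw [Metric.tendsto_nhds]
  intro ε hε
  filter_upwards [h (ε / 2) (half_pos hε)] with n hn
  have hp := zpow_pos hr n
  have h1 : ‖∑' x, F n x‖ ≤ ε / 2 / r ^ n :=
    IsUltrametricDist.norm_tsum_le_of_forall_le_of_nonneg (by positivity)
      fun x => (le_div_iff₀ hp).mpr (hn x)
  have h2 := (le_div_iff₀ hp).mp h1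
  rw [Real.dist_eq, sub_zero, abs_of_nonneg (by positivity)]
  linarith

theorem mul_null (f g : LaurentRing I) {r : ℝ} (hr : r ∈ I.carrier) :
    Tendsto (fun n : ℤ => ‖∑' i, f.coeff i * g.coeff (n - i)‖ * r ^ n) cofinite (𝓝 0) := by
  refine tendsto_tsum_weight (fun n i => f.coeff i * g.coeff (n - i)) (I.pos hr) fun ε hε => ?_
  have hfin : {x : ℤ × ℤ | ¬ (‖f.coeff x.1‖ * r ^ x.1) * (‖g.coeff x.2‖ * r ^ x.2) < ε}.Finite :=
    (tendsto_mul_pairs f g hr).eventually (gt_mem_nhds hε)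
  filter_upwards [(hfin.image fun x => x.1 + x.2).compl_mem_cofinite] with n hn i
  rw [weight_mul f g hr]
  by_contra hcon
  exact hn ⟨(i, n - i), fun hlt => hcon hlt.le, by simp⟩

instance : Mul (LaurentRing I) :=
  ⟨fun f g => ⟨fun n => ∑' i, f.coeff i * g.coeff (n - i), fun _ hr => mul_null f g hr⟩⟩

theorem coeff_mul (f g : LaurentRing I) (n : ℤ) :
    (f * g).coeff n = ∑' i, f.coeff i * g.coeff (n - i) := rfl

variable [CompleteSpace K]

theorem summable_of_weight {α : Type*} {F : α → K} {c : ℝ} (hc : 0 < c)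
    (h : Tendsto (fun x => ‖F x‖ * c) cofinite (𝓝 0)) : Summable F :=
  NonarchimedeanAddGroup.summable_of_tendsto_cofinite_zero (tendsto_zero_of_weight hc h)

theorem summable_mul (f g : LaurentRing I) (n : ℤ) :
    Summable fun i => f.coeff i * g.coeff (n - i) := by
  obtain ⟨r, hr⟩ := I.nonempty
  refine summable_of_weight (zpow_pos (I.pos hr) n) ?_
  have hinj : Function.Injective (fun i : ℤ => (i, n - i)) := fun a b h => (Prod.ext_iff.mp h).1
  exact ((tendsto_mul_pairs f g hr).comp hinj.tendsto_cofinite).congr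
    fun i => (weight_mul f g hr n i).symm

theorem mul_comm' (f g : LaurentRing I) : f * g = g * f := by
  ext n
  rw [coeff_mul, coeff_mul, ← (Equiv.subLeft n).tsum_eq]
  refine tsum_congr fun i => ?_
  simp [mul_comm]

theorem left_distrib' (f g h : LaurentRing I) : f * (g + h) = f * g + f * h := by
  ext n
  rw [coeff_add, coeff_mul, coeff_mul, coeff_mul,
    ← (summable_mul f g n).tsum_add (summable_mul f h n)]
  exact tsum_congr fun i => by simp [mul_add]

theorem coeff_monomial_mul (m : ℤ) (c : K) (f : LaurentRing I) (n : ℤ) :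
    (monomial m c * f).coeff n = c * f.coeff (n - m) := by
  rw [coeff_mul, tsum_eq_single m]
  · simp [coeff_monomial]
  · intro i hi
    simp [coeff_monomial, hi]

theorem one_mul' (f : LaurentRing I) : 1 * f = f := by
  ext n
  have h := coeff_monomial_mul 0 1 f n
  rw [one_mul, sub_zero] at h
  exact h

theorem summable_triple (f g h : LaurentRing I) (n : ℤ) :
    Summable fun x : ℤ × ℤ => f.coeff x.2 * g.coeff (x.1 - x.2) * h.coeff (n - x.1) := by
  obtain ⟨r, hr⟩ := I.nonempty
  have hr0 := I.pos hr
  refine summable_of_weight (zpow_pos hr0 n) ?_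
  have hinj : Function.Injective (fun x : ℤ × ℤ => ((x.2, x.1 - x.2), n - x.1)) := by
    rintro ⟨a, b⟩ ⟨c, d⟩ hx
    have h1 : b = d := congrArg (fun y => y.1.1) hx
    have h2 : n - a = n - c := congrArg (fun y => y.2) hx
    rw [h1, sub_right_injective h2]
  have ht := (tendsto_mul_cofinite_nhds_zero (tendsto_mul_pairs f g hr)
    (h.null' r hr)).comp hinj.tendsto_cofinite
  refine ht.congr fun x => ?_
  have h1 : r ^ n = r ^ x.2 * r ^ (x.1 - x.2) * r ^ (n - x.1) := by
    rw [← zpow_add₀ hr0.ne', ← zpow_add₀ hr0.ne']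
    congr 1
    ring
  rw [h1, norm_mul, norm_mul]
  simp only [Function.comp]
  ring

theorem mul_assoc' (f g h : LaurentRing I) : f * g * h = f * (g * h) := by
  ext n
  have h1 : (f * g * h).coeff n
      = ∑' m, ∑' i, f.coeff i * g.coeff (m - i) * h.coeff (n - m) := by
    rw [coeff_mul]
    exact tsum_congr fun m => by rw [coeff_mul, tsum_mul_right]
  have h2 : (f * (g * h)).coeff n
      = ∑' i, f.coeff i * ∑' k, g.coeff k * h.coeff (n - i - k) := by
    rw [coeff_mul]
    exact tsum_congr fun m => by rw [coeff_mul]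
  have h3 := Summable.tsum_comm
    (f := fun m i => f.coeff i * g.coeff (m - i) * h.coeff (n - m)) (summable_triple f g h n)
  rw [h1, h2, ← h3]
  refine tsum_congr fun i => ?_
  rw [← tsum_mul_left]
  rw [← (Equiv.addRight i).tsum_eq
    (fun m => f.coeff i * g.coeff (m - i) * h.coeff (n - m))]
  refine tsum_congr fun k => ?_
  have h4 : n - (k + i) = n - i - k := by ring
  rw [Equiv.coe_addRight, add_sub_cancel_right, h4, mul_assoc]

instance : CommRing (LaurentRing I) where
  add_assoc f g h := by ext; simp [add_assoc]
  zero_add f := by ext; simp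
  add_zero f := by ext; simp
  add_comm f g := by ext; simp [add_comm]
  neg_add_cancel f := by ext; simp
  nsmul := nsmulRec
  zsmul := zsmulRec
  mul_comm := mul_comm'
  mul_assoc := mul_assoc'
  one_mul := one_mul'
  mul_one f := by rw [mul_comm', one_mul']
  left_distrib := left_distrib'
  right_distrib f g h := by rw [mul_comm', left_distrib', mul_comm' h, mul_comm' h]
  zero_mul f := by ext n; simp [coeff_mul]
  mul_zero f := by ext n; simp [coeff_mul]

/-- The inclusion of the constants. -/
def C : K →+* LaurentRing I where
  toFun := monomial 0
  map_one' := rfl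
  map_zero' := by ext i; simp [coeff_monomial]
  map_add' a b := by ext i; by_cases h : i = 0 <;> simp [coeff_monomial, h]
  map_mul' a b := by
    ext i
    rw [coeff_monomial_mul]
    by_cases h : i = 0 <;> simp [coeff_monomial, h]

/-- Restriction of functions to a smaller annulus, as a ring homomorphism. -/
def restrict (h : I ≤ J) : LaurentRing J →+* LaurentRing I where
  toFun := restrictFun h
  map_one' := rfl
  map_zero' := rfl
  map_add' _ _ := rfl
  map_mul' _ _ := rfl

theorem gaussNorm_mul_le (f g : LaurentRing I) {r : ℝ} (hr : r ∈ I.carrier) :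
    gaussNorm r (f * g) ≤ gaussNorm r f * gaussNorm r g := by
  refine gaussNorm_le _ fun n => ?_
  have hp := zpow_pos (I.pos hr) n
  have hB := mul_nonneg (gaussNorm_nonneg f hr) (gaussNorm_nonneg g hr)
  rw [← le_div_iff₀ hp, coeff_mul]
  refine IsUltrametricDist.norm_tsum_le_of_forall_le_of_nonneg (by positivity) fun i => ?_
  rw [le_div_iff₀ hp, weight_mul f g hr]
  exact mul_le_mul (le_gaussNorm f hr i) (le_gaussNorm g hr _)
    (mul_nonneg (norm_nonneg _) (zpow_nonneg (I.pos hr).le _)) (gaussNorm_nonneg f hr)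

theorem gaussNorm_pow_le (f : LaurentRing I) {r : ℝ} (hr : r ∈ I.carrier) (m : ℕ) :
    gaussNorm r (f ^ m) ≤ gaussNorm r f ^ m := by
  induction m with
  | zero => simpa using gaussNorm_one_le
  | succ m ih =>
    rw [pow_succ, pow_succ]
    exact (gaussNorm_mul_le _ _ hr).trans
      (mul_le_mul_of_nonneg_right ih (gaussNorm_nonneg f hr))


theorem finite_large {α : Type*} {F : α → ℤ → ℝ} {W : α → ℝ} (hW : Tendsto W cofinite (𝓝 0))
    (hF : ∀ x, Tendsto (F x) cofinite (𝓝 0)) (hFW : ∀ x k, F x k ≤ W x) {ε : ℝ} (hε : 0 < ε) :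
    {y : α × ℤ | ¬ F y.1 y.2 < ε}.Finite := by
  have h1 : {x | ¬ W x < ε}.Finite := hW.eventually (gt_mem_nhds hε)
  have h2 : ∀ x, {k | ¬ F x k < ε}.Finite := fun x => (hF x).eventually (gt_mem_nhds hε)
  refine (h1.biUnion fun x _ => (h2 x).image (Prod.mk x)).subset ?_
  rintro ⟨x, k⟩ hy
  refine Set.mem_biUnion (x := x) (fun hlt => hy ((hFW x k).trans_lt hlt)) ⟨k, hy, rfl⟩

/-- For a unit `u` of `R_I`, the condition that the map `t ↦ u(t)` sends `A(I)` into `A(J)`: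
on every circle `|t| = r` of `A(I)`, the values `|u(t)|` lie between two elements of `J`. -/
def MapsInto (u : (LaurentRing I)ˣ) (J : AlignedInterval K) : Prop :=
  ∀ r ∈ I.carrier,
    (∃ b ∈ J.carrier, gaussNorm r (u : LaurentRing I) ≤ b) ∧
    (∃ a ∈ J.carrier, gaussNorm r ((u⁻¹ : (LaurentRing I)ˣ) : LaurentRing I) ≤ a⁻¹)

theorem gaussNorm_zpow_le (u : (LaurentRing I)ˣ) {r a b : ℝ} (hr : r ∈ I.carrier)
    (ha : 0 < a) (hb : 0 < b) (hub : gaussNorm r (u : LaurentRing I) ≤ b)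
    (hua : gaussNorm r ((u⁻¹ : (LaurentRing I)ˣ) : LaurentRing I) ≤ a⁻¹) (i : ℤ) :
    gaussNorm r ((u ^ i : (LaurentRing I)ˣ) : LaurentRing I) ≤ a ^ i + b ^ i := by
  have hai := zpow_pos ha i
  have hbi := zpow_pos hb i
  obtain ⟨m, rfl | rfl⟩ := i.eq_nat_or_neg
  · have h := (gaussNorm_pow_le (u : LaurentRing I) hr m).trans
      (pow_le_pow_left₀ (gaussNorm_nonneg _ hr) hub m)
    rw [zpow_natCast, Units.val_pow_eq_pow_val]
    rw [zpow_natCast] at hai hbi ⊢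
    rw [zpow_natCast]
    linarith
  · have h := (gaussNorm_pow_le ((u⁻¹ : (LaurentRing I)ˣ) : LaurentRing I) hr m).trans
      (pow_le_pow_left₀ (gaussNorm_nonneg _ hr) hua m)
    have h1 : ((u ^ (-(m : ℤ)) : (LaurentRing I)ˣ) : LaurentRing I)
        = ((u⁻¹ : (LaurentRing I)ˣ) : LaurentRing I) ^ m := by
      rw [zpow_neg, zpow_natCast, ← inv_pow, Units.val_pow_eq_pow_val]
    have h2 : a ^ (-(m : ℤ)) = a⁻¹ ^ m := by rw [zpow_neg, zpow_natCast, inv_pow]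
    rw [h1]
    rw [h2] at hai ⊢
    linarith

theorem pull_bound {s : K →+* K} (hs : ∀ x, ‖s x‖ ≤ ‖x‖) (u : (LaurentRing I)ˣ)
    (f : LaurentRing J) {r a b : ℝ} (hr : r ∈ I.carrier)
    (ha : a ∈ J.carrier) (hb : b ∈ J.carrier) (hub : gaussNorm r (u : LaurentRing I) ≤ b)
    (hua : gaussNorm r ((u⁻¹ : (LaurentRing I)ˣ) : LaurentRing I) ≤ a⁻¹) (i n : ℤ) :
    ‖s (f.coeff i) * ((u ^ i : (LaurentRing I)ˣ) : LaurentRing I).coeff n‖ * r ^ n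
      ≤ ‖f.coeff i‖ * (a ^ i + b ^ i) := by
  rw [norm_mul, mul_assoc]
  exact mul_le_mul (hs _) ((le_gaussNorm _ hr n).trans
    (gaussNorm_zpow_le u hr (J.pos ha) (J.pos hb) hub hua i))
    (mul_nonneg (norm_nonneg _) (zpow_nonneg (I.pos hr).le n)) (norm_nonneg _)

theorem pull_summable {s : K →+* K} (hs : ∀ x, ‖s x‖ ≤ ‖x‖) (u : (LaurentRing I)ˣ)
    (h : MapsInto u J) (f : LaurentRing J) (n : ℤ) :
    Summable fun i => s (f.coeff i) * ((u ^ i : (LaurentRing I)ˣ) : LaurentRing I).coeff n := by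
  obtain ⟨r, hr⟩ := I.nonempty
  obtain ⟨⟨b, hb, hub⟩, a, ha, hua⟩ := h r hr
  refine summable_of_weight (zpow_pos (I.pos hr) n) (squeeze_zero
    (fun i => mul_nonneg (norm_nonneg _) (zpow_nonneg (I.pos hr).le n))
    (fun i => pull_bound hs u f hr ha hb hub hua i n) (tendsto_weights f ha hb))

theorem pull_null {s : K →+* K} (hs : ∀ x, ‖s x‖ ≤ ‖x‖) (u : (LaurentRing I)ˣ)
    (h : MapsInto u J) (f : LaurentRing J) {r : ℝ} (hr : r ∈ I.carrier) :
    Tendsto (fun n : ℤ => ‖∑' i, s (f.coeff i) *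
      ((u ^ i : (LaurentRing I)ˣ) : LaurentRing I).coeff n‖ * r ^ n) cofinite (𝓝 0) := by
  obtain ⟨⟨b, hb, hub⟩, a, ha, hua⟩ := h r hr
  refine tendsto_tsum_weight (fun n i => s (f.coeff i) *
    ((u ^ i : (LaurentRing I)ˣ) : LaurentRing I).coeff n) (I.pos hr) fun ε hε => ?_
  have hfin := finite_large (F := fun i n => ‖s (f.coeff i) *
    ((u ^ i : (LaurentRing I)ˣ) : LaurentRing I).coeff n‖ * r ^ n) (tendsto_weights f ha hb)
    (fun i => by
      have h1 := (((u ^ i : (LaurentRing I)ˣ) : LaurentRing I).null' r hr).const_mul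
        ‖s (f.coeff i)‖
      rw [mul_zero] at h1
      exact h1.congr fun n => by rw [norm_mul, mul_assoc])
    (fun i n => pull_bound hs u f hr ha hb hub hua i n) hε
  filter_upwards [(hfin.image Prod.snd).compl_mem_cofinite] with n hn i
  by_contra hcon
  exact hn ⟨(i, n), fun hlt => hcon hlt.le, rfl⟩

/-- The function `∑ s(c_i) u^i` on `A(I)` attached to `f = ∑ c_i t^i` on `A(J)`. -/
def pullFun {s : K →+* K} (hs : ∀ x, ‖s x‖ ≤ ‖x‖) (u : (LaurentRing I)ˣ)
    (h : MapsInto u J) (f : LaurentRing J) : LaurentRing I :=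
  ⟨fun n => ∑' i, s (f.coeff i) * ((u ^ i : (LaurentRing I)ˣ) : LaurentRing I).coeff n,
    fun _ hr => pull_null hs u h f hr⟩

theorem coeff_pullFun {s : K →+* K} (hs : ∀ x, ‖s x‖ ≤ ‖x‖) (u : (LaurentRing I)ˣ)
    (h : MapsInto u J) (f : LaurentRing J) (n : ℤ) : (pullFun hs u h f).coeff n
      = ∑' i, s (f.coeff i) * ((u ^ i : (LaurentRing I)ˣ) : LaurentRing I).coeff n := rfl

theorem pull_summable_pairs {s : K →+* K} (hs : ∀ x, ‖s x‖ ≤ ‖x‖) (u : (LaurentRing I)ˣ)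
    (h : MapsInto u J) (f g : LaurentRing J) (n : ℤ) :
    Summable fun y : (ℤ × ℤ) × ℤ => s (f.coeff y.1.1) *
      ((u ^ y.1.1 : (LaurentRing I)ˣ) : LaurentRing I).coeff y.2 *
      (s (g.coeff y.1.2) * ((u ^ y.1.2 : (LaurentRing I)ˣ) : LaurentRing I).coeff (n - y.2)) := by
  obtain ⟨r, hr⟩ := I.nonempty
  obtain ⟨⟨b, hb, hub⟩, a, ha, hua⟩ := h r hr
  have hr0 := I.pos hr
  refine summable_of_weight (zpow_pos hr0 n) ?_
  have key : ∀ (x : ℤ × ℤ) (k : ℤ), ‖s (f.coeff x.1) *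
      ((u ^ x.1 : (LaurentRing I)ˣ) : LaurentRing I).coeff k *
      (s (g.coeff x.2) * ((u ^ x.2 : (LaurentRing I)ˣ) : LaurentRing I).coeff (n - k))‖ * r ^ n
      = (‖s (f.coeff x.1) * ((u ^ x.1 : (LaurentRing I)ˣ) : LaurentRing I).coeff k‖ * r ^ k) *
        (‖s (g.coeff x.2) * ((u ^ x.2 : (LaurentRing I)ˣ) : LaurentRing I).coeff (n - k)‖
          * r ^ (n - k)) := by
    intro x k
    have h1 : r ^ n = r ^ k * r ^ (n - k) := by
      rw [← zpow_add₀ hr0.ne']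
      congr 1
      ring
    rw [h1, norm_mul]
    ring
  have hnn : ∀ (c : K) (k : ℤ), 0 ≤ ‖c‖ * r ^ k := fun c k =>
    mul_nonneg (norm_nonneg _) (zpow_nonneg hr0.le k)
  rw [Metric.tendsto_nhds]
  intro ε hε
  have hfin := finite_large (α := ℤ × ℤ) (F := fun x k => ‖s (f.coeff x.1) *
      ((u ^ x.1 : (LaurentRing I)ˣ) : LaurentRing I).coeff k *
      (s (g.coeff x.2) * ((u ^ x.2 : (LaurentRing I)ˣ) : LaurentRing I).coeff (n - k))‖ * r ^ n)
    (tendsto_mul_cofinite_nhds_zero (tendsto_weights f ha hb) (tendsto_weights g ha hb))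
    (fun x => by
      have h1 := ((tendsto_mul_pairs ((u ^ x.1 : (LaurentRing I)ˣ) : LaurentRing I)
        ((u ^ x.2 : (LaurentRing I)ˣ) : LaurentRing I) hr).comp
        (Function.Injective.tendsto_cofinite (f := fun k : ℤ => (k, n - k))
          fun a b h => congrArg Prod.fst h)).const_mul
        (‖s (f.coeff x.1)‖ * ‖s (g.coeff x.2)‖)
      rw [mul_zero] at h1
      refine h1.congr fun k => ?_
      rw [key, norm_mul, norm_mul]
      simp only [Function.comp]
      ring)
    (fun x k => by
      rw [key]
      exact mul_le_mul (pull_bound hs u f hr ha hb hub hua x.1 k)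
        (pull_bound hs u g hr ha hb hub hua x.2 (n - k)) (hnn _ _)
        ((hnn _ _).trans (pull_bound hs u f hr ha hb hub hua x.1 k))) hε
  refine hfin.subset ?_
  intro y hy hlt
  refine hy ?_
  change dist _ (0 : ℝ) < ε
  rw [Real.dist_eq, sub_zero, abs_of_nonneg (hnn _ _)]
  exact hlt

theorem pullFun_mul {s : K →+* K} (hs : ∀ x, ‖s x‖ ≤ ‖x‖) (u : (LaurentRing I)ˣ)
    (h : MapsInto u J) (f g : LaurentRing J) :
    pullFun hs u h (f * g) = pullFun hs u h f * pullFun hs u h g := by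
  ext n
  have hsc : Continuous s := AddMonoidHomClass.continuous_of_bound s 1 fun x => by
    simpa using hs x
  have hS := pull_summable_pairs hs u h f g n
  -- the common value: a sum over pairs of exponents
  have hG : ∀ x : ℤ × ℤ, ∑' k, s (f.coeff x.1) *
      ((u ^ x.1 : (LaurentRing I)ˣ) : LaurentRing I).coeff k *
      (s (g.coeff x.2) * ((u ^ x.2 : (LaurentRing I)ˣ) : LaurentRing I).coeff (n - k))
      = s (f.coeff x.1) * s (g.coeff x.2) *
        ((u ^ (x.1 + x.2) : (LaurentRing I)ˣ) : LaurentRing I).coeff n := by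
    intro x
    rw [zpow_add, Units.val_mul, coeff_mul, ← tsum_mul_left]
    exact tsum_congr fun k => by ring
  have hGs : Summable fun x : ℤ × ℤ => s (f.coeff x.1) * s (g.coeff x.2) *
        ((u ^ (x.1 + x.2) : (LaurentRing I)ˣ) : LaurentRing I).coeff n :=
    hS.prod.congr fun x => hG x
  have hR : (pullFun hs u h f * pullFun hs u h g).coeff n = ∑' x : ℤ × ℤ,
      s (f.coeff x.1) * s (g.coeff x.2) *
        ((u ^ (x.1 + x.2) : (LaurentRing I)ˣ) : LaurentRing I).coeff n := by
    rw [coeff_mul, ← tsum_congr hG]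
    have hcomm := Summable.tsum_comm (f := fun (x : ℤ × ℤ) (k : ℤ) => s (f.coeff x.1) *
      ((u ^ x.1 : (LaurentRing I)ˣ) : LaurentRing I).coeff k *
      (s (g.coeff x.2) * ((u ^ x.2 : (LaurentRing I)ˣ) : LaurentRing I).coeff (n - k))) hS
    rw [← hcomm]
    refine tsum_congr fun k => ?_
    rw [coeff_pullFun, coeff_pullFun]
    have : NonarchimedeanRing K := ⟨NonarchimedeanAddGroup.is_nonarchimedean⟩
    exact tsum_mul_tsum_of_nonarchimedean (pull_summable hs u h f k)
      (pull_summable hs u h g (n - k))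
  have hL : (pullFun hs u h (f * g)).coeff n = ∑' x : ℤ × ℤ,
      s (f.coeff x.1) * s (g.coeff x.2) *
        ((u ^ (x.1 + x.2) : (LaurentRing I)ˣ) : LaurentRing I).coeff n := by
    obtain ⟨e, he⟩ : ∃ e : ℤ × ℤ ≃ ℤ × ℤ, ∀ y, e y = (y.2, y.1 - y.2) :=
      ⟨{ toFun := fun y => (y.2, y.1 - y.2)
         invFun := fun x => (x.1 + x.2, x.1)
         left_inv := fun y => by simp
         right_inv := fun x => by simp }, fun _ => rfl⟩
    have hterm : ∀ y : ℤ × ℤ, s (f.coeff (e y).1) * s (g.coeff (e y).2) *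
        ((u ^ ((e y).1 + (e y).2) : (LaurentRing I)ˣ) : LaurentRing I).coeff n
        = s (f.coeff y.2 * g.coeff (y.1 - y.2)) *
          ((u ^ y.1 : (LaurentRing I)ˣ) : LaurentRing I).coeff n := by
      intro y
      have h1 : y.2 + (y.1 - y.2) = y.1 := by ring
      rw [he, h1, map_mul]
    have hes : Summable fun y : ℤ × ℤ => s (f.coeff y.2 * g.coeff (y.1 - y.2)) *
        ((u ^ y.1 : (LaurentRing I)ˣ) : LaurentRing I).coeff n :=
      (e.summable_iff.mpr hGs).congr fun y => hterm y
    have h2 := e.tsum_eq fun x : ℤ × ℤ => s (f.coeff x.1) * s (g.coeff x.2) *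
        ((u ^ (x.1 + x.2) : (LaurentRing I)ˣ) : LaurentRing I).coeff n
    rw [← h2, tsum_congr hterm, hes.tsum_prod, coeff_pullFun]
    refine tsum_congr fun m => ?_
    rw [coeff_mul, (summable_mul f g m).map_tsum s hsc, ← tsum_mul_right]
  rw [hL, hR]

/-- The pullback `R_J → R_I`, `∑ c_i t^i ↦ ∑ s(c_i) u^i`, along the map `A(I) → A(J)` which
sends `t` to `u(t)` and acts on the constants through `s`. -/
def pullback {s : K →+* K} (hs : ∀ x, ‖s x‖ ≤ ‖x‖) (u : (LaurentRing I)ˣ)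
    (h : MapsInto u J) : LaurentRing J →+* LaurentRing I where
  toFun := pullFun hs u h
  map_one' := by
    ext n
    rw [coeff_pullFun, tsum_eq_single 0]
    · simp [coeff_one]
    · intro i hi
      simp [coeff_one, hi]
  map_zero' := by
    ext n
    simp [coeff_pullFun]
  map_add' f g := by
    ext n
    rw [coeff_add, coeff_pullFun, coeff_pullFun, coeff_pullFun,
      ← (pull_summable hs u h f n).tsum_add (pull_summable hs u h g n)]
    exact tsum_congr fun i => by rw [coeff_add, map_add, add_mul]
  map_mul' := pullFun_mul hs u h

end LaurentRing
end Ring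

section BaseChange

/-- `F : M → N`, semilinear along `φ : A → B`, identifies `N` with `B ⊗_A M`; that is, the
linearization `B ⊗_A M → N` of `F` is an isomorphism of `B`-modules. -/
def IsBaseChangeAlong {A B M N : Type*} [CommRing A] [CommRing B] (φ : A →+* B)
    [AddCommGroup M] [Module A M] [AddCommGroup N] [Module B N] (F : M →ₛₗ[φ] N) : Prop :=
  letI : Algebra A B := φ.toAlgebra
  letI : Module A N := Module.compHom N φ
  haveI : IsScalarTower A B N := ⟨fun a b x => mul_smul (φ a) b x⟩
  IsBaseChange B ({ toFun := F, map_add' := F.map_add, map_smul' := F.map_smulₛₗ } : M →ₗ[A] N)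

end BaseChange

open LaurentRing AlignedInterval

section Nabla

variable {K : Type u} [NormedField K] [IsUltrametricDist K] [CompleteSpace K]

/-- A `∇`-module on the annulus `A(X)`: a coherent locally free sheaf with a connection.

The annulus is the increasing union of the closed annuli `A(I)`, for `I` running over the closed
aligned subintervals of `X`. These are affinoid with coordinate rings `R_I`, so a coherent
locally free sheaf is given by its modules of sections `Γ(E, A(I))`, which are finite projective
over `R_I` and are compatible with base change along the restrictions `R_J → R_I`. As `Ω¹` is
freely generated by `dt`, a connection is the same as an action of `d/dt` which satisfies the
Leibniz rule. -/
structure NablaModule (X : AlignedInterval K) where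
  /-- the sections `Γ(E, A(I))` -/
  obj : ClosedSub X → Type v
  [addCommGroup : ∀ I, AddCommGroup (obj I)]
  [module : ∀ I : ClosedSub X, Module (LaurentRing I.toAlignedInterval) (obj I)]
  finite : ∀ I : ClosedSub X, Module.Finite (LaurentRing I.toAlignedInterval) (obj I)
  projective : ∀ I : ClosedSub X, Module.Projective (LaurentRing I.toAlignedInterval) (obj I)
  /-- the restriction maps -/
  res : ∀ {I J : ClosedSub X} (h : I.toAlignedInterval ≤ J.toAlignedInterval),
    obj J →ₛₗ[restrict h] obj I
  res_self : ∀ (I : ClosedSub X) (v : obj I), res (le_rfl' I.toAlignedInterval) v = v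
  res_res : ∀ {I J L : ClosedSub X} (h : I.toAlignedInterval ≤ J.toAlignedInterval)
    (h' : J.toAlignedInterval ≤ L.toAlignedInterval) (v : obj L),
    res h (res h' v) = res (le_trans' h h') v
  res_isBaseChange : ∀ {I J : ClosedSub X} (h : I.toAlignedInterval ≤ J.toAlignedInterval),
    IsBaseChangeAlong (restrict h) (res h)
  /-- the action of `d/dt` -/
  D : ∀ I, obj I →+ obj I
  leibniz : ∀ (I : ClosedSub X) (f : LaurentRing I.toAlignedInterval) (v : obj I),
    D I (f • v) = f.deriv • v + f • D I v
  D_res : ∀ {I J : ClosedSub X} (h : I.toAlignedInterval ≤ J.toAlignedInterval) (v : obj J),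
    D I (res h v) = res h (D J v)

attribute [instance] NablaModule.addCommGroup NablaModule.module

namespace NablaModule

variable {X : AlignedInterval K}

/-- A sequence `w_0, w_1, …` of sections over a closed annulus `A(I)` is `η`-null if, in terms of
generators `e_1, …, e_m` of `Γ(E, A(I))`, the norms on `A(I)` of the coefficients of `w_j`,
multiplied by `η^j`, tend to zero. This is required for every finite generating family, for
suitable coefficients; if `e` is a basis, they are the coordinates. -/
def IsEtaNull (E : NablaModule.{u, v} X) (I : ClosedSub X) (η : ℝ) (w : ℕ → E.obj I) : Prop :=
  ∀ (m : ℕ) (e : Fin m → E.obj I),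
    Submodule.span (LaurentRing I.toAlignedInterval) (Set.range e) = ⊤ →
    ∃ c : ℕ → Fin m → LaurentRing I.toAlignedInterval,
      (∀ j, w j = ∑ i, c j i • e i) ∧
      ∀ ε > 0, ∀ᶠ j in atTop, ∀ i, ∀ ρ ∈ I.carrier, gaussNorm ρ (c j i) * η ^ j < ε

/-- For an `η`-null sequence, the coordinates in terms of any basis are `η`-null. -/
theorem IsEtaNull.basis {E : NablaModule.{u, v} X} {I : ClosedSub X} {η : ℝ} {w : ℕ → E.obj I}
    (h : E.IsEtaNull I η w) {m : ℕ}
    (b : Module.Basis (Fin m) (LaurentRing I.toAlignedInterval) (E.obj I)) :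
    ∀ ε > 0, ∀ᶠ j in atTop, ∀ i, ∀ ρ ∈ I.carrier, gaussNorm ρ (b.repr (w j) i) * η ^ j < ε := by
  obtain ⟨c, hc, hlim⟩ := h m b b.span_eq
  have hcb : ∀ j i, b.repr (w j) i = c j i := fun j i => by
    rw [hc j, b.repr_sum_self]
  simpa only [hcb] using hlim

/-- A `∇`-module on `A[r,1)` is overconvergent if for every `η ∈ (0,1)` there is `s ∈ (0,1)`
such that for each closed aligned subinterval `I` of `[s,1)` and each section `v` over `A(I)`,
the sequence `(1/j!) (d/dt)^j v` is `η`-null. -/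
def IsOverconvergent {r : ℝ} {hr : r ∈ divValueGroup K} {hr1 : r < 1}
    (E : NablaModule.{u, v} (ico r hr hr1)) : Prop :=
  ∀ η : ℝ, 0 < η → η < 1 → ∃ s : ℝ, r ≤ s ∧ s < 1 ∧
    ∀ I : ClosedSub (ico r hr hr1), (∀ ρ ∈ I.carrier, s ≤ ρ) → ∀ v : E.obj I,
      E.IsEtaNull I η fun j =>
        (C ((j.factorial : K)⁻¹) : LaurentRing I.toAlignedInterval) • (E.D I)^[j] v

end NablaModule

end Nabla

section Frobenius

/-- A continuous endomorphism `σ_K` of `K` which acts on `𝔬_K` modulo `𝔪_K` as the `q`-th power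
Frobenius, `q = p ^ n`. -/
structure BaseFrobenius (K : Type u) [NormedField K] (p n : ℕ) where
  toRingHom : K →+* K
  continuous : Continuous toRingHom
  frob : ∀ x : K, ‖x‖ ≤ 1 → ‖toRingHom x - x ^ (p ^ n)‖ < 1

variable {K : Type u} [NormedField K] [IsUltrametricDist K] {p n : ℕ}

theorem BaseFrobenius.norm_le_one (σ : BaseFrobenius K p n) {x : K} (hx : ‖x‖ ≤ 1) :
    ‖σ.toRingHom x‖ ≤ 1 := by
  have h1 := IsUltrametricDist.norm_add_le_max (σ.toRingHom x - x ^ (p ^ n)) (x ^ (p ^ n))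
  rw [sub_add_cancel] at h1
  refine h1.trans (max_le (σ.frob x hx).le ?_)
  rw [norm_pow]
  exact pow_le_one₀ (norm_nonneg x) hx

variable [Fact p.Prime] [Fact (‖(p : K)‖ = (p : ℝ)⁻¹)]

theorem BaseFrobenius.norm_le (σ : BaseFrobenius K p n) (x : K) :
    ‖σ.toRingHom x‖ ≤ ‖x‖ := by
  by_contra! hlt
  have hp : (1 : ℝ) < p := by exact_mod_cast (Fact.out : p.Prime).one_lt
  have hp0 : (0 : ℝ) < p := by linarith
  have hx : x ≠ 0 := by
    rintro rfl
    simp at hlt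
  have hα : 0 < ‖x‖ := norm_pos_iff.mpr hx
  obtain ⟨k, hk⟩ := pow_unbounded_of_one_lt (p : ℝ) ((one_lt_div hα).mpr hlt)
  obtain ⟨m, hm1, hm2⟩ := exists_mem_Ioc_zpow (pow_pos hα k) hp
  have hpn : ‖(p : K)‖ = (p : ℝ)⁻¹ := Fact.out
  have hz : 0 < (p : ℝ) ^ (m + 1) := zpow_pos hp0 _
  have h1 : ‖x ^ k * (p : K) ^ (m + 1)‖ ≤ 1 := by
    rw [norm_mul, norm_pow, norm_zpow, hpn, inv_zpow, ← div_eq_mul_inv, div_le_one hz]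
    exact hm2
  have h2 := σ.norm_le_one h1
  rw [map_mul, map_pow, map_zpow₀, map_natCast, norm_mul, norm_pow, norm_zpow, hpn, inv_zpow,
    ← div_eq_mul_inv, div_le_one hz] at h2
  rw [div_pow, lt_div_iff₀ (pow_pos hα k)] at hk
  have h3 : (p : ℝ) ^ (m + 1) = p * (p : ℝ) ^ m := by rw [zpow_add_one₀ hp0.ne', mul_comm]
  rw [h3] at h2
  have h4 := mul_lt_mul_of_pos_left hm1 hp0
  linarith

variable [CompleteSpace K]

/-- A Frobenius lift of order `n` extending `σ_K`: a map `σ : A[a,1) → A[a^q,1)`, acting through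
`σ_K` on the constants, which reduces to the `q`-th power map (`q = p ^ n`). Such a map is
determined by the function `u = σ^*(t)`, and reduces to the `q`-th power map exactly when all
coefficients of `u - t^q` belong to `𝔪_K`. -/
structure FrobeniusLift (σK : BaseFrobenius K p n) where
  a : ℝ
  a_mem : a ∈ divValueGroup K
  a_lt : a < 1
  u : (LaurentRing (ico a a_mem a_lt))ˣ
  mapsInto : MapsInto u (ico (a ^ (p ^ n)) (divValueGroup_pow a_mem _)
    (pow_lt_one₀ a_mem.1.le a_lt (pow_ne_zero n (Fact.out : p.Prime).ne_zero)))
  reduction : ∀ i : ℤ, ‖((u : LaurentRing (ico a a_mem a_lt))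
    - monomial ((p ^ n : ℕ) : ℤ) 1).coeff i‖ < 1

namespace FrobeniusLift

variable {σK : BaseFrobenius K p n} (σ : FrobeniusLift σK)

/-- The restriction of `u = σ^*(t)` to `A(I)`, for `I ⊆ [a,1)`. -/
def uOn {I : AlignedInterval K} (h : I ≤ ico σ.a σ.a_mem σ.a_lt) : (LaurentRing I)ˣ :=
  Units.map (restrict h : LaurentRing (ico σ.a σ.a_mem σ.a_lt) →* LaurentRing I) σ.u

/-- The pullback of functions `σ^* : R_J → R_I`, for `σ(A(I)) ⊆ A(J)`. -/
def comorphism {I J : AlignedInterval K} (h : I ≤ ico σ.a σ.a_mem σ.a_lt)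
    (hm : MapsInto (σ.uOn h) J) : LaurentRing J →+* LaurentRing I :=
  pullback σK.norm_le (σ.uOn h) hm

end FrobeniusLift

/-- A Frobenius structure on a `∇`-module `E` on `A[r,1)`: an isomorphism `F : σ^* E → E` of
`∇`-modules on some `A[s,1)`, where `s` is such that `E` and `σ^* E` are defined on `A[s,1)`.
It is given by the corresponding `σ`-linear maps `Γ(E, A(J)) → Γ(E, A(I))` for
`σ(A(I)) ⊆ A(J)`. -/
structure FrobeniusStructure {σK : BaseFrobenius K p n} (σ : FrobeniusLift σK)
    {r : ℝ} {hr : r ∈ divValueGroup K} {hr1 : r < 1}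
    (E : NablaModule.{u, v} (ico r hr hr1)) where
  s : ℝ
  s_mem : s ∈ divValueGroup K
  s_lt : s < 1
  r_le : r ≤ s
  le_dom : ico s s_mem s_lt ≤ ico σ.a σ.a_mem σ.a_lt
  /-- `σ` maps `A[s,1)` into `A[r,1)` -/
  exists_target : ∀ (I : ClosedSub (ico r hr hr1)) (hI : I.toAlignedInterval ≤ ico s s_mem s_lt),
    ∃ J : ClosedSub (ico r hr hr1),
      MapsInto (σ.uOn (le_trans' hI le_dom)) J.toAlignedInterval
  map : ∀ (I J : ClosedSub (ico r hr hr1)) (hI : I.toAlignedInterval ≤ ico s s_mem s_lt)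
    (hm : MapsInto (σ.uOn (le_trans' hI le_dom)) J.toAlignedInterval),
    E.obj J →ₛₗ[σ.comorphism (le_trans' hI le_dom) hm] E.obj I
  map_res : ∀ (I J J' : ClosedSub (ico r hr hr1))
    (hI : I.toAlignedInterval ≤ ico s s_mem s_lt)
    (hm : MapsInto (σ.uOn (le_trans' hI le_dom)) J.toAlignedInterval)
    (hm' : MapsInto (σ.uOn (le_trans' hI le_dom)) J'.toAlignedInterval)
    (h : J.toAlignedInterval ≤ J'.toAlignedInterval) (v : E.obj J'),
    map I J hI hm (E.res h v) = map I J' hI hm' v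
  res_map : ∀ (I I' J : ClosedSub (ico r hr hr1))
    (hI : I.toAlignedInterval ≤ ico s s_mem s_lt)
    (hI' : I'.toAlignedInterval ≤ ico s s_mem s_lt)
    (hm : MapsInto (σ.uOn (le_trans' hI le_dom)) J.toAlignedInterval)
    (hm' : MapsInto (σ.uOn (le_trans' hI' le_dom)) J.toAlignedInterval)
    (h : I'.toAlignedInterval ≤ I.toAlignedInterval) (v : E.obj J),
    E.res h (map I J hI hm v) = map I' J hI' hm' v
  /-- the linearization `σ^* E → E` is an isomorphism -/
  isBaseChange : ∀ (I J : ClosedSub (ico r hr hr1))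
    (hI : I.toAlignedInterval ≤ ico s s_mem s_lt)
    (hm : MapsInto (σ.uOn (le_trans' hI le_dom)) J.toAlignedInterval),
    IsBaseChangeAlong (σ.comorphism (le_trans' hI le_dom) hm) (map I J hI hm)
  /-- `F` is horizontal, where `d/dt` acts on `σ^* E` by `1 ⊗ v ↦ u' ⊗ (d/dt) v` -/
  horizontal : ∀ (I J : ClosedSub (ico r hr hr1))
    (hI : I.toAlignedInterval ≤ ico s s_mem s_lt)
    (hm : MapsInto (σ.uOn (le_trans' hI le_dom)) J.toAlignedInterval) (v : E.obj J),
    E.D I (map I J hI hm v) =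
      ((σ.uOn (le_trans' hI le_dom) : (LaurentRing I.toAlignedInterval)ˣ) :
        LaurentRing I.toAlignedInterval).deriv • map I J hI hm (E.D J v)

end Frobenius

end PadicAnnuli

end

set_option linter.unusedSectionVars false

noncomputable section

namespace PadicAnnuli

universe u v

/-! ### Gauss norms and divided derivatives of Laurent series. -/

namespace LaurentRing

variable {K : Type u} [NormedField K] {I J : AlignedInterval K}

/-! The `η`-null condition is a statement about the Taylor series `∑ X^j (1/j!) D^j v`. It holds as
soon as these series are bounded on discs of some radius `β > η`. So the point is that the radius
`R(ρ)` of these discs on the circle `|t| = ρ` tends to `1` as `ρ → 1`. Write `R(ρ) = ρ e^y` with `y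
≤ 0`.

Let `u = σ^*(t) = t^q + g`. Horizontality of Frobenius is the chain rule: the Taylor series of `F v`
is that of `v` with `u(t + X) - u(t)` substituted for the variable (`divD_map`). Hence a radius `ρ^q
e^y` on the circle `ρ^q` gives a radius `ρ e^{y'}` on the circle `ρ`, provided that the substitution
maps the second disc into the first. By the binomial expansion of `(t + X)^q` this needs `y' ≤ y /
q` and `y' ≤ y + log p`, and it needs `|g|_ρ e^{y'} ≤ ρ^q e^y` for the error term
(`gaussNorm_divDeriv_mul_le`). If only the first condition were binding, iteration would replace `y`
by `y / q` each time, and `y` would tend to `0`.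

The difficulty is the error term. Its coefficients have absolute value `< 1` but need not be bounded
away from `1`, so that near `ρ = 1` one has only `|g|_ρ ≤ ρ^N` for each fixed `N`
(`eventually_gaussNorm_le_pow`). The resulting condition `y' ≤ y + M (-log ρ)` degenerates as `ρ →
1`. The remedy is concavity: by Hadamard's three circles theorem, applied to the coordinates of all
`(1/j!) D^j v`, the supremum of the admissible `y` at `ρ = exp(-x / q^k)` has increments in `k` of
at most `D / q^k`. This is of the same order as `-log ρ`. For `M` large compared with `D`, neither
additive condition is binding when `k` is large, and the value at step `k + 1` is at least `1 / q`
times that at step `k` (`eventually_neg_mem_of_concave`).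

The maximum principle passes from these circles to the annuli between them. Since the modules are
only projective, boundedness is tested on linear functionals, and generators with coordinate
functionals replace bases. Some positive radius to start from comes from the crude bound `|1/j!| ≤
p^j`. -/

theorem gaussNorm_add_le (f g : LaurentRing I) [IsUltrametricDist K] {r : ℝ}
    (hr : r ∈ I.carrier) : gaussNorm r (f + g) ≤ max (gaussNorm r f) (gaussNorm r g) := by
  refine gaussNorm_le _ fun i => ?_
  have hp := zpow_nonneg (I.pos hr).le i
  rw [coeff_add]
  calc ‖f.coeff i + g.coeff i‖ * r ^ i
      ≤ max ‖f.coeff i‖ ‖g.coeff i‖ * r ^ i :=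
        mul_le_mul_of_nonneg_right (IsUltrametricDist.norm_add_le_max _ _) hp
    _ = max (‖f.coeff i‖ * r ^ i) (‖g.coeff i‖ * r ^ i) := max_mul_of_nonneg _ _ hp
    _ ≤ _ := max_le_max (le_gaussNorm f hr i) (le_gaussNorm g hr i)

theorem gaussNorm_zero (r : ℝ) : gaussNorm r (0 : LaurentRing I) = 0 := by
  simp [gaussNorm]

theorem gaussNorm_monomial_le {r : ℝ} (hr : r ∈ I.carrier) (m : ℤ) (c : K) :
    gaussNorm r (monomial m c : LaurentRing I) ≤ ‖c‖ * r ^ m := by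
  have h0 := mul_nonneg (norm_nonneg c) (zpow_nonneg (I.pos hr).le m)
  refine gaussNorm_le _ fun i => ?_
  rw [coeff_monomial]
  split_ifs with h
  · rw [h]
  · simpa using h0

/-- Hadamard's three circles theorem, for the radii `a ^ (q ^ 2)`, `a ^ q`, `a`. -/
theorem gaussNorm_three_circles (f : LaurentRing I) {a : ℝ} {q : ℕ} (h0 : a ^ (q ^ 2) ∈ I.carrier)
    (h1 : a ^ q ∈ I.carrier) (h2 : a ∈ I.carrier) :
    gaussNorm (a ^ q) f ^ (q + 1) ≤ gaussNorm a f ^ q * gaussNorm (a ^ (q ^ 2)) f := by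
  have hB : 0 ≤ gaussNorm a f ^ q * gaussNorm (a ^ (q ^ 2)) f :=
    mul_nonneg (pow_nonneg (gaussNorm_nonneg f h2) q) (gaussNorm_nonneg f h0)
  have ha := I.pos h2
  -- Each coefficient satisfies the inequality in `(q + 1)`-st powers. Extracting the root first
  -- allows the supremum over the coefficients to be taken before raising to the power.
  obtain ⟨B, hB0, hBe⟩ : ∃ B : ℝ, 0 ≤ B ∧ B ^ (q + 1) =
      gaussNorm a f ^ q * gaussNorm (a ^ (q ^ 2)) f :=
    ⟨_, Real.rpow_nonneg hB _, Real.rpow_inv_natCast_pow hB (Nat.succ_ne_zero q)⟩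
  rw [← hBe]
  refine pow_le_pow_left₀ (gaussNorm_nonneg f h1) (gaussNorm_le f fun i => ?_) _
  refine le_of_pow_le_pow_left₀ (Nat.succ_ne_zero q) hB0 ?_
  have hz : ∀ s ∈ I.carrier, 0 ≤ ‖f.coeff i‖ * s ^ i := fun s hs =>
    mul_nonneg (norm_nonneg _) (zpow_nonneg (I.pos hs).le i)
  have h3 := mul_le_mul (pow_le_pow_left₀ (hz a h2) (le_gaussNorm f h2 i) q)
    (le_gaussNorm f h0 i) (hz _ h0) (pow_nonneg (gaussNorm_nonneg f h2) q)
  rw [hBe]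
  refine le_trans (le_of_eq ?_) h3
  have h4 : (a ^ q) ^ i = (a ^ i) ^ q := by
    rw [← zpow_natCast, ← zpow_natCast, ← zpow_mul, ← zpow_mul, mul_comm]
  have h5 : (a ^ (q ^ 2)) ^ i = (a ^ i) ^ (q ^ 2) := by
    rw [← zpow_natCast, ← zpow_natCast, ← zpow_mul, ← zpow_mul, mul_comm]
  rw [h4, h5, Nat.succ_eq_add_one]
  ring

/-- The maximum principle. -/
theorem gaussNorm_le_max (f : LaurentRing I) {a b r : ℝ} (ha : a ∈ I.carrier)
    (hb : b ∈ I.carrier) (har : a ≤ r) (hrb : r ≤ b) :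
    gaussNorm r f ≤ max (gaussNorm a f) (gaussNorm b f) := by
  have ha0 := I.pos ha
  have hr0 := ha0.trans_le har
  refine gaussNorm_le f fun i => ?_
  obtain ⟨m, rfl | rfl⟩ := i.eq_nat_or_neg
  · refine le_max_of_le_right (le_trans ?_ (le_gaussNorm f hb (m : ℤ)))
    rw [zpow_natCast, zpow_natCast]
    gcongr
  · refine le_max_of_le_left (le_trans ?_ (le_gaussNorm f ha (-(m : ℤ))))
    rw [zpow_neg, zpow_neg, zpow_natCast, zpow_natCast]
    gcongr

theorem exists_gaussNorm_le (f : LaurentRing I) (hI : IsCompact I.carrier) :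
    ∃ B : ℝ, 0 ≤ B ∧ ∀ r ∈ I.carrier, gaussNorm r f ≤ B := by
  obtain ⟨a, ha⟩ := hI.exists_isLeast I.nonempty
  obtain ⟨b, hb⟩ := hI.exists_isGreatest I.nonempty
  exact ⟨_, le_max_of_le_left (gaussNorm_nonneg f ha.1), fun r hr =>
    gaussNorm_le_max f ha.1 hb.1 (ha.2 hr) (hb.2 hr)⟩

/-- If all coefficients of `g` on `A[a,1)` have absolute value `< 1`, then `|g|_ρ` is eventually
smaller than any given power of `ρ`, as `ρ → 1`. -/
theorem eventually_gaussNorm_le_pow {a : ℝ} {ha : a ∈ divValueGroup K} {h1 : a < 1}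
    (g : LaurentRing (AlignedInterval.ico a ha h1)) (hg : ∀ i, ‖g.coeff i‖ < 1) (N : ℕ) :
    ∀ᶠ r in 𝓝[<] (1 : ℝ), gaussNorm r g ≤ r ^ N := by
  have ha0 : 0 < a := ha.1
  -- The exceptional exponents are finite in number, and for each of them `|c_i| < 1` suffices in
  -- the limit `r → 1`. Of the others, those `≥ N` need only `|c_i| ≤ 1`. The negative ones satisfy
  -- `|c_i| r^i ≤ |c_i| a^i < 1/2 < r^N`.
  have hfin : ({i : ℤ | ¬ ‖g.coeff i‖ * a ^ i < 1 / 2} ∪ Set.Ico 0 (N : ℤ)).Finite :=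
    Set.Finite.union ((g.null' a ⟨le_rfl, h1⟩).eventually (gt_mem_nhds one_half_pos))
      (Set.finite_Ico 0 (N : ℤ))
  have hbad : ∀ᶠ r in 𝓝[<] (1 : ℝ), ∀ i ∈ ({i : ℤ | ¬ ‖g.coeff i‖ * a ^ i < 1 / 2} ∪
      Set.Ico 0 (N : ℤ)), ‖g.coeff i‖ * r ^ i < r ^ N := by
    rw [eventually_all_finite hfin]
    intro i _
    have hl : Tendsto (fun r : ℝ => ‖g.coeff i‖ * r ^ i) (𝓝[<] 1) (𝓝 (‖g.coeff i‖ * 1 ^ i)) :=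
      ((continuousAt_zpow₀ (1 : ℝ) i (Or.inl one_ne_zero)).tendsto.mono_left
        nhdsWithin_le_nhds).const_mul _
    have hr : Tendsto (fun r : ℝ => r ^ N) (𝓝[<] 1) (𝓝 (1 ^ N)) :=
      ((continuous_pow N).tendsto 1).mono_left nhdsWithin_le_nhds
    exact hl.eventually_lt hr (by simpa using hg i)
  have hhalf : ∀ᶠ r in 𝓝[<] (1 : ℝ), 1 / 2 < r ^ N :=
    (((continuous_pow N).tendsto (1 : ℝ)).mono_left nhdsWithin_le_nhds).eventually_const_lt
      (by norm_num)
  have hIoo : ∀ᶠ r in 𝓝[<] (1 : ℝ), r ∈ Set.Ioo a 1 := Ioo_mem_nhdsLT h1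
  filter_upwards [hbad, hhalf, hIoo] with r hb hh hr
  have hr0 : 0 < r := ha0.trans hr.1
  refine gaussNorm_le g fun i => ?_
  by_cases hi : i ∈ ({i : ℤ | ¬ ‖g.coeff i‖ * a ^ i < 1 / 2} ∪ Set.Ico 0 (N : ℤ))
  · exact (hb i hi).le
  · have hi1 : ‖g.coeff i‖ * a ^ i < 1 / 2 := not_not.mp (not_or.mp hi).1
    have hi2 : ¬ (0 ≤ i ∧ i < N) := (not_or.mp hi).2
    by_cases hi0 : 0 ≤ i
    · obtain ⟨m, rfl⟩ := Int.eq_ofNat_of_zero_le hi0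
      have hm : N ≤ m := by omega
      rw [zpow_natCast]
      calc ‖g.coeff m‖ * r ^ m ≤ 1 * r ^ m := by gcongr; exact (hg _).le
        _ ≤ r ^ N := by rw [one_mul]; exact pow_le_pow_of_le_one hr0.le hr.2.le hm
    · obtain ⟨m, hm | hm⟩ := i.eq_nat_or_neg
      · omega
      · subst hm
        refine le_trans ?_ (hi1.trans hh).le
        rw [zpow_neg, zpow_neg, zpow_natCast, zpow_natCast]
        have := hr.1.le
        gcongr

variable [IsUltrametricDist K]

theorem gaussNorm_sum_le {α : Type*} (s : Finset α) (f : α → LaurentRing I) {r B : ℝ}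
    (hr : r ∈ I.carrier) (hB : 0 ≤ B) (h : ∀ x ∈ s, gaussNorm r (f x) ≤ B)
    [CompleteSpace K] : gaussNorm r (∑ x ∈ s, f x) ≤ B := by
  classical
  induction s using Finset.induction_on with
  | empty => simpa [gaussNorm_zero] using hB
  | insert x s hx ih =>
    rw [Finset.sum_insert hx]
    exact (gaussNorm_add_le _ _ hr).trans (max_le (h x (Finset.mem_insert_self x s))
      (ih fun y hy => h y (Finset.mem_insert_of_mem hy)))

theorem coeff_deriv (f : LaurentRing I) (i : ℤ) :
    f.deriv.coeff i = ((i + 1 : ℤ) : K) * f.coeff (i + 1) := rfl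

variable [CompleteSpace K]

theorem deriv_add (f g : LaurentRing I) : (f + g).deriv = f.deriv + g.deriv := by
  ext i
  simp only [coeff_deriv, coeff_add, mul_add]

/-- After a shift of the index, both terms run over the products `f_i g_{n+1-i}`, with weights `n +
1 - i` and `i` that add up to `n + 1`. -/
theorem deriv_mul (f g : LaurentRing I) : (f * g).deriv = f * g.deriv + g * f.deriv := by
  ext n
  have e := (Equiv.addRight (1 : ℤ)).tsum_eq
    fun i => f.coeff i * ((i : K) * g.coeff (n + 1 - i))
  have h1 : (g * f.deriv).coeff n = ∑' i : ℤ, (i : K) * (f.coeff i * g.coeff (n + 1 - i)) := by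
    rw [mul_comm, coeff_mul, ← (Equiv.addRight (1 : ℤ)).tsum_eq
      fun i : ℤ => (i : K) * (f.coeff i * g.coeff (n + 1 - i))]
    refine tsum_congr fun i => ?_
    rw [coeff_deriv, Equiv.coe_addRight, show n + 1 - (i + 1) = n - i by ring, mul_assoc]
  have h2 : (f * g.deriv).coeff n
      = ∑' i : ℤ, ((n + 1 - i : ℤ) : K) * (f.coeff i * g.coeff (n + 1 - i)) := by
    rw [coeff_mul]
    refine tsum_congr fun i => ?_
    rw [coeff_deriv, show n - i + 1 = n + 1 - i by ring]
    ring
  have s1 : Summable fun i : ℤ => (i : K) * (f.coeff i * g.coeff (n + 1 - i)) := by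
    have := summable_mul f.deriv g n
    rw [← (Equiv.addRight (1 : ℤ)).summable_iff]
    refine this.congr fun i => ?_
    simp only [Function.comp, Equiv.coe_addRight]
    rw [coeff_deriv, show n + 1 - (i + 1) = n - i by ring, mul_assoc]
  have s2 : Summable fun i : ℤ => ((n + 1 - i : ℤ) : K) * (f.coeff i * g.coeff (n + 1 - i)) := by
    refine (summable_mul f g.deriv n).congr fun i => ?_
    rw [coeff_deriv, show n - i + 1 = n + 1 - i by ring]
    ring
  rw [coeff_add, h1, h2, ← s2.tsum_add s1, coeff_deriv, coeff_mul, ← tsum_mul_left]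
  refine tsum_congr fun i => ?_
  push_cast
  ring

/-- `d/dt` as a derivation. -/
def derivation (I : AlignedInterval K) : Derivation ℤ (LaurentRing I) (LaurentRing I) :=
  Derivation.mk' (AddMonoidHom.mk' deriv deriv_add).toIntLinearMap deriv_mul

theorem derivation_apply (f : LaurentRing I) : derivation I f = f.deriv := rfl

theorem deriv_C_mul (c : K) (f : LaurentRing I) : (C c * f).deriv = C c * f.deriv := by
  have hC : ∀ (g : LaurentRing I) i, (C c * g).coeff i = c * g.coeff i := fun g i => by
    have := coeff_monomial_mul 0 c g i
    rwa [sub_zero] at this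
  ext i
  rw [coeff_deriv, hC, hC, coeff_deriv]
  ring

theorem deriv_monomial (m : ℤ) (c : K) :
    (monomial m c : LaurentRing I).deriv = monomial (m - 1) (m * c) := by
  ext i
  rw [coeff_deriv, coeff_monomial, coeff_monomial]
  by_cases h : i = m - 1
  · subst h
    simp
  · rw [if_neg h, if_neg (by omega), mul_zero]

/-- The divided power `(1/j!) (d/dt)^j` of `d/dt`. -/
def divDeriv (j : ℕ) (f : LaurentRing I) : LaurentRing I :=
  C ((j.factorial : K)⁻¹) * deriv^[j] f

theorem divDeriv_zero (f : LaurentRing I) : divDeriv 0 f = f := by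
  simp [divDeriv]

/-- The factor `2` comes from `pull_bound` with both radii equal to `b`. It is harmless, because
only boundedness of sequences is at stake. -/
theorem gaussNorm_pullback_le {s : K →+* K} (hs : ∀ x, ‖s x‖ ≤ ‖x‖) (w : (LaurentRing I)ˣ)
    (h : MapsInto w J) (f : LaurentRing J) {r b : ℝ} (hr : r ∈ I.carrier) (hb : b ∈ J.carrier)
    (hw : gaussNorm r (w : LaurentRing I) ≤ b)
    (hw' : gaussNorm r ((w⁻¹ : (LaurentRing I)ˣ) : LaurentRing I) ≤ b⁻¹) :
    gaussNorm r (pullback hs w h f) ≤ 2 * gaussNorm b f := by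
  refine gaussNorm_le _ fun n => ?_
  have hp := zpow_pos (I.pos hr) n
  have hB := gaussNorm_nonneg f hb
  rw [← le_div_iff₀ hp]
  change ‖∑' i, s (f.coeff i) * ((w ^ i : (LaurentRing I)ˣ) : LaurentRing I).coeff n‖ ≤ _
  refine IsUltrametricDist.norm_tsum_le_of_forall_le_of_nonneg (by positivity) fun i => ?_
  rw [le_div_iff₀ hp]
  refine (pull_bound hs w f hr hb hb hw hw' i n).trans ?_
  have := le_gaussNorm f hb i
  linarith

variable [CharZero K]

theorem C_factorial_succ (j : ℕ) : ((j + 1 : ℕ) : LaurentRing I) *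
    C (((j + 1).factorial : K)⁻¹) = C ((j.factorial : K)⁻¹) := by
  rw [← map_natCast (C : K →+* LaurentRing I), ← map_mul, Nat.factorial_succ, Nat.cast_mul,
    mul_inv, ← mul_assoc, mul_inv_cancel₀ (Nat.cast_ne_zero.mpr (Nat.succ_ne_zero j)), one_mul]

theorem deriv_divDeriv (j : ℕ) (f : LaurentRing I) :
    (divDeriv j f).deriv = (j + 1 : ℕ) * divDeriv (j + 1) f := by
  rw [divDeriv, divDeriv, ← mul_assoc, C_factorial_succ, deriv_C_mul, Function.iterate_succ_apply']

theorem coeff_iterate_deriv (f : LaurentRing I) (j : ℕ) (i : ℤ) : (deriv^[j] f).coeff i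
    = (((ascPochhammer ℤ j).eval (i + 1) : ℤ) : K) * f.coeff (i + j) := by
  induction j generalizing i with
  | zero => simp
  | succ j ih =>
    rw [Function.iterate_succ_apply', coeff_deriv, ih, ascPochhammer_succ_left]
    simp only [Polynomial.eval_mul, Polynomial.eval_X, Polynomial.eval_comp, Polynomial.eval_add,
      Polynomial.eval_one]
    rw [← mul_assoc, ← Int.cast_mul]
    congr 2
    push_cast
    ring

/-- The operator `(1/j!) (d/dt)^j` multiplies coefficients by generalized binomial coefficients.
These are integers, also at negative exponents, so the division by `j!` costs nothing. -/
theorem gaussNorm_divDeriv_le (j : ℕ) (f : LaurentRing I) {r : ℝ} (hr : r ∈ I.carrier) :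
    gaussNorm r (divDeriv j f) * r ^ j ≤ gaussNorm r f := by
  have hr0 := I.pos hr
  rw [← le_div_iff₀ (pow_pos hr0 j)]
  refine gaussNorm_le _ fun i => ?_
  have hC : (divDeriv j f).coeff i = (j.factorial : K)⁻¹ * (deriv^[j] f).coeff i := by
    have := coeff_monomial_mul 0 ((j.factorial : K)⁻¹) (deriv^[j] f) i
    rwa [sub_zero] at this
  have hpoch : (ascPochhammer ℤ j).eval (i + 1) = j.factorial * Ring.multichoose (i + 1) j := by
    rw [← Polynomial.ascPochhammer_smeval_eq_eval,
      ← Ring.factorial_nsmul_multichoose_eq_ascPochhammer, nsmul_eq_mul]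
  have h1 : (divDeriv j f).coeff i = ((Ring.multichoose (i + 1) j : ℤ) : K) * f.coeff (i + j) := by
    rw [hC, coeff_iterate_deriv, hpoch, Int.cast_mul, Int.cast_natCast, ← mul_assoc, ← mul_assoc,
      inv_mul_cancel₀ (Nat.cast_ne_zero.mpr j.factorial_ne_zero), one_mul]
  rw [le_div_iff₀ (pow_pos hr0 j), h1, norm_mul, mul_assoc, ← zpow_natCast, ← zpow_add₀ hr0.ne']
  have h2 := IsUltrametricDist.norm_intCast_le_one K (Ring.multichoose (i + 1) j)
  rw [mul_assoc]
  exact (mul_le_of_le_one_left (mul_nonneg (norm_nonneg _) (zpow_nonneg hr0.le _)) h2).trans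
    (le_gaussNorm f hr _)

theorem divDeriv_monomial (q j : ℕ) : divDeriv j (monomial (q : ℤ) 1 : LaurentRing I)
    = monomial ((q : ℤ) - j) (q.choose j : K) := by
  have h1 : deriv^[j] (monomial (q : ℤ) 1 : LaurentRing I)
      = monomial ((q : ℤ) - j) (q.descFactorial j : K) := by
    induction j with
    | zero => simp
    | succ j ih =>
      rw [Function.iterate_succ_apply', ih, deriv_monomial, Nat.descFactorial_succ]
      -- For `j > q` the truncated difference is wrong, but the descending factorial vanishes.
      have h2 : (((q : ℤ) - j : ℤ) : K) * (q.descFactorial j : K)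
          = ((q - j) * q.descFactorial j : ℕ) := by
        rcases le_or_gt j q with h | h
        · push_cast [h]
          rfl
        · rw [Nat.descFactorial_eq_zero_iff_lt.mpr h]
          simp
      rw [h2]
      congr 1
      push_cast
      ring
  rw [divDeriv, h1]
  ext i
  have := coeff_monomial_mul 0 ((j.factorial : K)⁻¹)
    (monomial ((q : ℤ) - j) (q.descFactorial j : K) : LaurentRing I) i
  rw [sub_zero] at this
  refine this.trans ?_
  rw [coeff_monomial, coeff_monomial, Nat.descFactorial_eq_factorial_mul_choose, Nat.cast_mul]
  split_ifs
  · rw [← mul_assoc, inv_mul_cancel₀ (Nat.cast_ne_zero.mpr j.factorial_ne_zero), one_mul]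
  · rw [mul_zero]

end LaurentRing

/-! ### Semilinear base change and coordinate functionals. -/

section BaseChange

variable {A B M N : Type*} [CommRing A] [CommRing B] {φ : A →+* B}
  [AddCommGroup M] [Module A M] [AddCommGroup N] [Module B N] {F : M →ₛₗ[φ] N}

/-- The universal property of base change, applied to `φ ∘ l`. It allows a functional over a large
annulus to be estimated on a smaller one. -/
theorem IsBaseChangeAlong.exists_functional (h : IsBaseChangeAlong φ F) (l : M →ₗ[A] A) :
    ∃ l' : N →ₗ[B] B, ∀ v, l' (F v) = φ (l v) := by
  let : Algebra A B := φ.toAlgebra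
  let : Module A N := Module.compHom N φ
  have : IsScalarTower A B N := ⟨fun a b x => mul_smul (φ a) b x⟩
  have h' : IsBaseChange B
    ({ toFun := F, map_add' := F.map_add, map_smul' := F.map_smulₛₗ } : M →ₗ[A] N) := h
  exact ⟨h'.lift ((Algebra.linearMap A B).comp l), fun v => h'.lift_eq _ v⟩

theorem IsBaseChangeAlong.span_eq_top (h : IsBaseChangeAlong φ F) {ι : Type*} {e : ι → M}
    (he : Submodule.span A (Set.range e) = ⊤) :
    Submodule.span B (Set.range fun i => F (e i)) = ⊤ := by
  let : Algebra A B := φ.toAlgebra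
  let : Module A N := Module.compHom N φ
  have : IsScalarTower A B N := ⟨fun a b x => mul_smul (φ a) b x⟩
  have h' : IsBaseChange B
    ({ toFun := F, map_add' := F.map_add, map_smul' := F.map_smulₛₗ } : M →ₗ[A] N) := h
  rw [eq_top_iff]
  intro x _
  refine h'.inductionOn x (· ∈ Submodule.span B (Set.range fun i => F (e i)))
    (Submodule.zero_mem _) (fun v => ?_) (fun b n hn => Submodule.smul_mem _ b hn)
    (fun a b ha hb => Submodule.add_mem _ ha hb)
  change F v ∈ _
  have hv : v ∈ Submodule.span A (Set.range e) := he ▸ Submodule.mem_top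
  induction hv using Submodule.span_induction with
  | mem y hy =>
    obtain ⟨i, rfl⟩ := hy
    exact Submodule.subset_span ⟨i, rfl⟩
  | zero => simp
  | add y z _ _ hy hz => rw [map_add]; exact Submodule.add_mem _ hy hz
  | smul a y _ hy => rw [F.map_smulₛₗ]; exact Submodule.smul_mem _ _ hy

/-- Projectivity splits the surjection from the free module on the generators. The components of the
splitting serve as coordinates although `e` need not be a basis. -/
theorem exists_dual_of_span_eq_top [Module.Projective A M] {m : ℕ} {e : Fin m → M}
    (he : Submodule.span A (Set.range e) = ⊤) :
    ∃ l : Fin m → M →ₗ[A] A, ∀ v, v = ∑ i, l i v • e i := by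
  have hs : Function.Surjective (Fintype.linearCombination A e) := by
    rw [← LinearMap.range_eq_top, Fintype.range_linearCombination, he]
  obtain ⟨g, hg⟩ := Module.projective_lifting_property _ LinearMap.id hs
  refine ⟨fun i => (LinearMap.proj i).comp g, fun v => ?_⟩
  have := LinearMap.congr_fun hg v
  rw [LinearMap.comp_apply, Fintype.linearCombination_apply] at this
  exact this.symm

end BaseChange

/-! ### Sequences of functions of bounded geometric growth. -/

namespace LaurentRing

variable {K : Type u} [NormedField K] {I J : AlignedInterval K}

/-- The norms of the functions `f_j`, multiplied by `β ^ j`, are bounded on `A(I)`. -/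
def IsBoundedSeq (β : ℝ) (f : ℕ → LaurentRing I) : Prop :=
  ∃ B : ℝ, 0 ≤ B ∧ ∀ j, ∀ r ∈ I.carrier, gaussNorm r (f j) * β ^ j ≤ B

variable {β : ℝ}

theorem IsBoundedSeq.mono {f : ℕ → LaurentRing I} (h : IsBoundedSeq β f) {β' : ℝ} (h0 : 0 ≤ β')
    (hb : β' ≤ β) : IsBoundedSeq β' f := by
  obtain ⟨B, hB, h⟩ := h
  exact ⟨B, hB, fun j r hr => (mul_le_mul_of_nonneg_left (pow_le_pow_left₀ h0 hb j)
    (gaussNorm_nonneg _ hr)).trans (h j r hr)⟩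

variable [IsUltrametricDist K] [CompleteSpace K]

theorem IsBoundedSeq.sum {α : Type*} {s : Finset α} {f : α → ℕ → LaurentRing I} (hβ : 0 < β)
    (h : ∀ x ∈ s, IsBoundedSeq β (f x)) : IsBoundedSeq β fun j => ∑ x ∈ s, f x j := by
  choose! B hB hf using h
  have hS : 0 ≤ ∑ x ∈ s, B x := Finset.sum_nonneg hB
  refine ⟨∑ x ∈ s, B x, hS, fun j r hr => ?_⟩
  rw [← le_div_iff₀ (pow_pos hβ j)]
  refine gaussNorm_sum_le _ _ hr (by positivity) fun x hx => ?_
  rw [le_div_iff₀ (pow_pos hβ j)]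
  exact (hf x hx j r hr).trans (Finset.single_le_sum hB hx)

theorem IsBoundedSeq.mul_const {f : ℕ → LaurentRing I} (hI : IsCompact I.carrier) (hβ : 0 ≤ β)
    (h : IsBoundedSeq β f) (g : LaurentRing I) : IsBoundedSeq β fun j => f j * g := by
  obtain ⟨B, hB, hf⟩ := h
  obtain ⟨G, hG, hg⟩ := exists_gaussNorm_le g hI
  refine ⟨B * G, mul_nonneg hB hG, fun j r hr => ?_⟩
  calc gaussNorm r (f j * g) * β ^ j ≤ gaussNorm r (f j) * gaussNorm r g * β ^ j :=
        mul_le_mul_of_nonneg_right (gaussNorm_mul_le _ _ hr) (pow_nonneg hβ j)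
    _ = gaussNorm r (f j) * β ^ j * gaussNorm r g := by ring
    _ ≤ B * G := mul_le_mul (hf j r hr) (hg r hr) (gaussNorm_nonneg _ hr) hB

theorem IsBoundedSeq.cauchy_prod {f g : ℕ → LaurentRing I} (hβ : 0 < β) (hf : IsBoundedSeq β f)
    (hg : IsBoundedSeq β g) :
    IsBoundedSeq β fun j => ∑ x ∈ Finset.HasAntidiagonal.antidiagonal j, f x.1 * g x.2 := by
  obtain ⟨B, hB, hf⟩ := hf
  obtain ⟨G, hG, hg⟩ := hg
  refine ⟨B * G, mul_nonneg hB hG, fun j r hr => ?_⟩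
  rw [← le_div_iff₀ (pow_pos hβ j)]
  refine gaussNorm_sum_le _ _ hr (by positivity) fun x hx => ?_
  rw [le_div_iff₀ (pow_pos hβ j), ← Finset.HasAntidiagonal.mem_antidiagonal.mp hx, pow_add]
  have hx1 := pow_nonneg hβ.le x.1
  have hx2 := pow_nonneg hβ.le x.2
  calc gaussNorm r (f x.1 * g x.2) * (β ^ x.1 * β ^ x.2)
      ≤ gaussNorm r (f x.1) * gaussNorm r (g x.2) * (β ^ x.1 * β ^ x.2) :=
        mul_le_mul_of_nonneg_right (gaussNorm_mul_le _ _ hr) (mul_nonneg hx1 hx2)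
    _ = gaussNorm r (f x.1) * β ^ x.1 * (gaussNorm r (g x.2) * β ^ x.2) := by ring
    _ ≤ B * G := mul_le_mul (hf _ r hr) (hg _ r hr)
        (mul_nonneg (gaussNorm_nonneg _ hr) hx2) hB

theorem isBoundedSeq_divDeriv [CharZero K] (hI : IsCompact I.carrier) (hβ : 0 ≤ β)
    (h : ∀ r ∈ I.carrier, β ≤ r) (f : LaurentRing I) : IsBoundedSeq β fun j => divDeriv j f := by
  obtain ⟨B, hB, hf⟩ := exists_gaussNorm_le f hI
  refine ⟨B, hB, fun j r hr => ?_⟩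
  exact ((mul_le_mul_of_nonneg_left (pow_le_pow_left₀ hβ (h r hr) j)
    (gaussNorm_nonneg _ hr)).trans (gaussNorm_divDeriv_le j f hr)).trans (hf r hr)

end LaurentRing

/-! ### Taylor series of sections and their boundedness. -/

namespace NablaModule

open LaurentRing

variable {K : Type u} [NormedField K] [IsUltrametricDist K] [CompleteSpace K]
  {X : AlignedInterval K} (E : NablaModule.{u, v} X) {I J : ClosedSub X}

/-- The divided power `(1/j!) (d/dt)^j` on the sections over `A(I)`. -/
def divD (I : ClosedSub X) (j : ℕ) (v : E.obj I) : E.obj I :=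
  (C ((j.factorial : K)⁻¹) : LaurentRing I.toAlignedInterval) • (E.D I)^[j] v

theorem divD_zero (v : E.obj I) : E.divD I 0 v = v := by
  simp [divD]

theorem divD_add (j : ℕ) (v w : E.obj I) : E.divD I j (v + w) = E.divD I j v + E.divD I j w := by
  rw [divD, divD, divD, iterate_map_add, smul_add]

theorem divD_sum {α : Type*} (s : Finset α) (j : ℕ) (v : α → E.obj I) :
    E.divD I j (∑ x ∈ s, v x) = ∑ x ∈ s, E.divD I j (v x) :=
  map_sum (AddMonoidHom.mk' (E.divD I j) (E.divD_add j)) v s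

theorem D_C_smul (c : K) (v : E.obj I) : E.D I
    ((C c : LaurentRing I.toAlignedInterval) • v) =
    (C c : LaurentRing I.toAlignedInterval) • E.D I v := by
  have h : (C c : LaurentRing I.toAlignedInterval).deriv = 0 := by
    change (monomial 0 c : LaurentRing I.toAlignedInterval).deriv = 0
    rw [deriv_monomial]
    ext i
    simp [coeff_monomial]
  rw [E.leibniz, h, zero_smul, zero_add]

theorem D_res_iterate (h : I.toAlignedInterval ≤ J.toAlignedInterval) (j : ℕ) (v : E.obj J) :
    (E.D I)^[j] (E.res h v) = E.res h ((E.D J)^[j] v) := by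
  induction j with
  | zero => rfl
  | succ j ih => rw [Function.iterate_succ_apply', ih, E.D_res, Function.iterate_succ_apply']

theorem divD_res (h : I.toAlignedInterval ≤ J.toAlignedInterval) (j : ℕ) (v : E.obj J) :
    E.divD I j (E.res h v) = E.res h (E.divD J j v) := by
  rw [divD, divD, D_res_iterate, (E.res h).map_smulₛₗ]
  rfl

/-- The sequence of sections `w_j`, multiplied by `β ^ j`, is bounded on `A(I)`: this holds for its
image under every linear functional. -/
def IsBoundedSeq (I : ClosedSub X) (β : ℝ) (w : ℕ → E.obj I) : Prop :=
  ∀ l : E.obj I →ₗ[LaurentRing I.toAlignedInterval] LaurentRing I.toAlignedInterval,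
    LaurentRing.IsBoundedSeq β fun j => l (w j)

/-- The Taylor series of the sections over `A(I)` are bounded on discs of radius `β`. -/
def IsTaylorBounded (I : ClosedSub X) (β : ℝ) : Prop :=
  ∀ v : E.obj I, E.IsBoundedSeq I β fun j => E.divD I j v

variable {E} {β : ℝ}

theorem IsTaylorBounded.mono (h : E.IsTaylorBounded I β) {β' : ℝ} (h0 : 0 ≤ β') (hb : β' ≤ β) :
    E.IsTaylorBounded I β' := fun v l => (h v l).mono h0 hb

theorem isBoundedSeq_of_span (hβ : 0 < β) {m : ℕ} {e : Fin m → E.obj I} {w : ℕ → E.obj I}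
    {c : ℕ → Fin m → LaurentRing I.toAlignedInterval} (hw : ∀ j, w j = ∑ i, c j i • e i)
    (hc : ∀ i, LaurentRing.IsBoundedSeq β fun j => c j i) : E.IsBoundedSeq I β w := by
  intro l
  have h1 : (fun j => l (w j)) = fun j => ∑ i, c j i * l (e i) := by
    funext j
    rw [hw, map_sum]
    exact Finset.sum_congr rfl fun i _ => by rw [map_smul, smul_eq_mul]
  rw [h1]
  exact IsBoundedSeq.sum hβ fun i _ => (hc i).mul_const I.isCompact hβ.le _

theorem exists_generators (E : NablaModule.{u, v} X) (I : ClosedSub X) : ∃ (m : ℕ) (e : Fin m → E.obj I),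
    Submodule.span (LaurentRing I.toAlignedInterval) (Set.range e) = ⊤ := by
  obtain ⟨m, e, he⟩ := (E.finite I).exists_fin
  exact ⟨m, e, he⟩

/-- A semilinear map which is bounded on functions preserves bounded sequences of sections. -/
theorem IsBoundedSeq.map (hβ : 0 < β)
    {φ : LaurentRing J.toAlignedInterval →+* LaurentRing I.toAlignedInterval}
    (F : E.obj J →ₛₗ[φ] E.obj I) {M : ℝ} (hM : 0 ≤ M) (hφ : ∀ f, ∀ r ∈ I.carrier, ∃ r' ∈ J.carrier,
      gaussNorm r (φ f) ≤ M * gaussNorm r' f) {w : ℕ → E.obj J} (hw : E.IsBoundedSeq J β w) :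
    E.IsBoundedSeq I β fun j => F (w j) := by
  obtain ⟨m, e, he⟩ := exists_generators E J
  have := E.projective J
  obtain ⟨l, hl⟩ := exists_dual_of_span_eq_top he
  refine isBoundedSeq_of_span hβ (e := fun i => F (e i)) (c := fun j i => φ (l i (w j)))
    (fun j => ?_) fun i => ?_
  · conv_lhs => rw [hl (w j)]
    rw [map_sum]
    exact Finset.sum_congr rfl fun i _ => F.map_smulₛₗ _ _
  · obtain ⟨B, hB, h⟩ := hw (l i)
    refine ⟨M * B, mul_nonneg hM hB, fun j r hr => ?_⟩
    obtain ⟨r', hr', h'⟩ := hφ (l i (w j)) r hr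
    calc gaussNorm r (φ (l i (w j))) * β ^ j ≤ M * gaussNorm r' (l i (w j)) * β ^ j :=
          mul_le_mul_of_nonneg_right h' (pow_nonneg hβ.le j)
      _ = M * (gaussNorm r' (l i (w j)) * β ^ j) := by ring
      _ ≤ M * B := mul_le_mul_of_nonneg_left (h j r' hr') hM

theorem IsBoundedSeq.res (hβ : 0 < β) (h : I.toAlignedInterval ≤ J.toAlignedInterval)
    {w : ℕ → E.obj J} (hw : E.IsBoundedSeq J β w) : E.IsBoundedSeq I β fun j => E.res h (w j) :=
  hw.map hβ (E.res h) zero_le_one fun f r hr => ⟨r, h hr, by rw [one_mul]; rfl⟩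

/-- A functional over `A(J)`, applied to a sequence of sections which is bounded on `A(I)`. -/
theorem IsBoundedSeq.exists_bound_of_res {h : I.toAlignedInterval ≤ J.toAlignedInterval}
    {w : ℕ → E.obj J} (hw : E.IsBoundedSeq I β fun j => E.res h (w j))
    (l : E.obj J →ₗ[LaurentRing J.toAlignedInterval] LaurentRing J.toAlignedInterval) :
    ∃ B : ℝ, 0 ≤ B ∧ ∀ j, ∀ r ∈ I.carrier, gaussNorm r (l (w j)) * β ^ j ≤ B := by
  obtain ⟨l', hl'⟩ := (E.res_isBaseChange h).exists_functional l
  obtain ⟨B, hB, hb⟩ := hw l'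
  refine ⟨B, hB, fun j r hr => ?_⟩
  rw [show gaussNorm r (l (w j)) = gaussNorm r (l' (E.res h (w j))) by rw [hl']; rfl]
  exact hb j r hr

variable [CharZero K]

theorem D_divD (j : ℕ) (v : E.obj I) : E.D I (E.divD I j v)
    = ((j + 1 : ℕ) : LaurentRing I.toAlignedInterval) • E.divD I (j + 1) v := by
  rw [divD, divD, smul_smul, C_factorial_succ, D_C_smul, Function.iterate_succ_apply']

theorem natCast_smul_cancel {n : ℕ} (hn : n ≠ 0) {v w : E.obj I}
    (h : (n : LaurentRing I.toAlignedInterval) • v = (n : LaurentRing I.toAlignedInterval) • w) :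
    v = w := by
  have h1 : (C ((n : K)⁻¹) : LaurentRing I.toAlignedInterval) * n = 1 := by
    rw [← map_natCast (C : K →+* LaurentRing I.toAlignedInterval), ← map_mul,
      inv_mul_cancel₀ (Nat.cast_ne_zero.mpr hn), map_one]
  have h2 := congrArg (fun x => (C ((n : K)⁻¹) : LaurentRing I.toAlignedInterval) • x) h
  simpa only [smul_smul, h1, one_smul] using h2

/-- Leibniz's rule for divided powers, which have no binomial coefficients. In the induction, the
factor `j + 1` can be cancelled in characteristic `0`, and on the antidiagonal it splits as `x.1 +
x.2`. -/
theorem divD_smul (j : ℕ) (f : LaurentRing I.toAlignedInterval) (v : E.obj I) :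
    E.divD I j (f • v)
      = ∑ x ∈ Finset.HasAntidiagonal.antidiagonal j, divDeriv x.1 f • E.divD I x.2 v := by
  induction j with
  | zero => simp [divD_zero, divDeriv_zero]
  | succ j ih =>
    refine natCast_smul_cancel (Nat.succ_ne_zero j) ?_
    have h1 : ((j + 1 : ℕ) : LaurentRing I.toAlignedInterval) •
        ∑ x ∈ Finset.HasAntidiagonal.antidiagonal (j + 1), divDeriv x.1 f • E.divD I x.2 v
        = ∑ x ∈ Finset.HasAntidiagonal.antidiagonal (j + 1),
            (x.1 : LaurentRing I.toAlignedInterval) • divDeriv x.1 f • E.divD I x.2 v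
          + ∑ x ∈ Finset.HasAntidiagonal.antidiagonal (j + 1),
            (x.2 : LaurentRing I.toAlignedInterval) • divDeriv x.1 f • E.divD I x.2 v := by
      rw [Finset.smul_sum, ← Finset.sum_add_distrib]
      refine Finset.sum_congr rfl fun x hx => ?_
      rw [← add_smul, ← Nat.cast_add, Finset.HasAntidiagonal.mem_antidiagonal.mp hx]
    rw [← D_divD, ih, map_sum, h1, Finset.Nat.sum_antidiagonal_succ,
      Finset.Nat.sum_antidiagonal_succ', Nat.cast_zero, zero_smul, zero_smul, zero_add, zero_add,
      ← Finset.sum_add_distrib]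
    refine Finset.sum_congr rfl fun x _ => ?_
    rw [E.leibniz, deriv_divDeriv, D_divD, mul_smul]
    congr 1
    exact smul_comm _ _ _

/-- By Leibniz's rule the Taylor series of `∑ f_i e_i` is a sum of Cauchy products. The hypothesis
`β ≤ r` makes the Taylor series of the functions `f_i` themselves bounded. -/
theorem isTaylorBounded_of_span (hβ : 0 < β) (hI : ∀ r ∈ I.carrier, β ≤ r) {m : ℕ}
    {e : Fin m → E.obj I} (he : Submodule.span (LaurentRing I.toAlignedInterval) (Set.range e) = ⊤)
    (h : ∀ i, E.IsBoundedSeq I β fun j => E.divD I j (e i)) : E.IsTaylorBounded I β := by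
  have := E.projective I
  obtain ⟨l, hl⟩ := exists_dual_of_span_eq_top he
  intro v l'
  have h1 : ∀ j, l' (E.divD I j v) = ∑ i, ∑ x ∈ Finset.HasAntidiagonal.antidiagonal j,
      divDeriv x.1 (l i v) * l' (E.divD I x.2 (e i)) := by
    intro j
    have h2 : E.divD I j v = ∑ i, E.divD I j (l i v • e i) := by
      rw [← divD_sum, ← hl v]
    rw [h2, map_sum]
    refine Finset.sum_congr rfl fun i _ => ?_
    rw [divD_smul, map_sum]
    exact Finset.sum_congr rfl fun x _ => by rw [map_smul, smul_eq_mul]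
  have h3 : ∀ i ∈ Finset.univ, LaurentRing.IsBoundedSeq β fun j =>
      ∑ x ∈ Finset.HasAntidiagonal.antidiagonal j,
        divDeriv x.1 (l i v) * l' (E.divD I x.2 (e i)) := fun i _ =>
    IsBoundedSeq.cauchy_prod (f := fun j => divDeriv j (l i v))
      (g := fun j => l' (E.divD I j (e i))) hβ
      (isBoundedSeq_divDeriv I.isCompact hβ.le hI (l i v)) (h i l')
  have h4 := IsBoundedSeq.sum hβ h3
  rw [funext h1]
  exact h4

end NablaModule

/-! ### The `p`-adic size of factorials and binomial coefficients. -/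

section NatNorm

variable {K : Type u} [NormedField K] [IsUltrametricDist K] {p : ℕ} [Fact p.Prime]
  [Fact (‖(p : K)‖ = (p : ℝ)⁻¹)]

/-- In a Bézout relation `1 = p x + m y`, the first term has norm `< 1`, so the second must have
norm at least `1`. -/
theorem one_le_norm_natCast_of_coprime {m : ℕ} (h : Nat.Coprime p m) : 1 ≤ ‖(m : K)‖ := by
  have hp : ‖(p : K)‖ < 1 := by
    rw [(Fact.out : ‖(p : K)‖ = (p : ℝ)⁻¹)]
    exact inv_lt_one_of_one_lt₀ (by exact_mod_cast (Fact.out : p.Prime).one_lt)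
  by_contra! hm
  have hb := Nat.gcd_eq_gcd_ab p m
  rw [Nat.Coprime.gcd_eq_one h] at hb
  have h1 : (1 : K) = p * (p.gcdA m : ℤ) + m * (p.gcdB m : ℤ) := by
    have hc := congrArg (Int.cast : ℤ → K) hb
    push_cast at hc
    exact hc
  have hA := IsUltrametricDist.norm_intCast_le_one K (p.gcdA m)
  have hB := IsUltrametricDist.norm_intCast_le_one K (p.gcdB m)
  have h2 := IsUltrametricDist.norm_add_le_max ((p : K) * (p.gcdA m : ℤ)) (m * (p.gcdB m : ℤ))
  rw [← h1, norm_one, norm_mul, norm_mul] at h2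
  rcases le_max_iff.mp h2 with h3 | h3
  · exact absurd (h3.trans (mul_le_of_le_one_right (norm_nonneg _) hA)) (not_le.mpr hp)
  · exact absurd (h3.trans (mul_le_of_le_one_right (norm_nonneg _) hB)) (not_le.mpr hm)

/-- The valuation of `j!` is at most `j`. This crude bound suffices, since it serves only to produce
some positive radius of convergence. -/
theorem norm_factorial_inv_le (j : ℕ) : ‖((j.factorial : K)⁻¹)‖ ≤ (p : ℝ) ^ j := by
  have hp1 : 1 < (p : ℝ) := by exact_mod_cast (Fact.out : p.Prime).one_lt
  have hp0 : 0 < (p : ℝ) := by linarith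
  obtain ⟨k, m, hm, hjm⟩ := Nat.exists_eq_pow_mul_and_not_dvd j.factorial_ne_zero p
    (Fact.out : p.Prime).ne_one
  have hk : k ≤ j := ((padicValNat_dvd_iff_le j.factorial_ne_zero).mp
    (hjm ▸ dvd_mul_right _ _)).trans (padicValNat_factorial_le p j)
  have h1 : 1 ≤ ‖(m : K)‖ := one_le_norm_natCast_of_coprime (p := p)
    (((Fact.out : p.Prime).coprime_iff_not_dvd).mpr hm)
  rw [hjm, Nat.cast_mul, Nat.cast_pow, norm_inv, norm_mul, norm_pow,
    (Fact.out : ‖(p : K)‖ = (p : ℝ)⁻¹), mul_inv, ← inv_pow, inv_inv]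
  calc (p : ℝ) ^ k * ‖(m : K)‖⁻¹ ≤ (p : ℝ) ^ k * 1 := by
        gcongr
        exact inv_le_one_of_one_le₀ h1
    _ ≤ (p : ℝ) ^ j := by
        rw [mul_one]
        exact pow_le_pow_right₀ hp1.le hk

theorem norm_choose_le {n i : ℕ} (hi : i ≠ 0) (hi' : i ≠ p ^ n) :
    ‖((p ^ n).choose i : K)‖ ≤ (p : ℝ)⁻¹ := by
  obtain ⟨c, hc⟩ := (Fact.out : p.Prime).dvd_choose_pow hi hi'
  rw [hc, Nat.cast_mul, norm_mul, (Fact.out : ‖(p : K)‖ = (p : ℝ)⁻¹)]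
  have h := IsUltrametricDist.norm_natCast_le_one K c
  exact mul_le_of_le_one_right (by positivity) h

end NatNorm

/-! ### Powers of the Taylor difference `w(t + X) - w(t)`. -/

namespace LaurentRing

variable {K : Type u} [NormedField K] [IsUltrametricDist K] [CompleteSpace K]
  {I J : AlignedInterval K}

/-- The coefficientwise action of `d/dt` on power series over the ring of functions. -/
def coeffDerivation (I : AlignedInterval K) :
    Derivation ℤ (PowerSeries (LaurentRing I)) (PowerSeries (LaurentRing I)) :=
  Derivation.mk' (AddMonoidHom.mk' (fun f : PowerSeries (LaurentRing I) =>
      PowerSeries.mk fun n => (PowerSeries.coeff n f).deriv)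
    (fun f g => by
      ext1 n
      simp only [PowerSeries.coeff_mk, map_add, deriv_add])).toIntLinearMap (fun f g => by
      ext1 n
      change PowerSeries.coeff n (PowerSeries.mk fun n => (PowerSeries.coeff n (f * g)).deriv) =
        PowerSeries.coeff n (f * (PowerSeries.mk fun n => (PowerSeries.coeff n g).deriv) +
          g * (PowerSeries.mk fun n => (PowerSeries.coeff n f).deriv))
      rw [PowerSeries.coeff_mk, PowerSeries.coeff_mul, map_add, mul_comm g, PowerSeries.coeff_mul,
        PowerSeries.coeff_mul, ← derivation_apply, map_sum, ← Finset.sum_add_distrib]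
      refine Finset.sum_congr rfl fun x _ => ?_
      rw [Derivation.leibniz, smul_eq_mul, smul_eq_mul, PowerSeries.coeff_mk,
        PowerSeries.coeff_mk, derivation_apply, derivation_apply]
      ring)

theorem coeff_coeffDerivation (f : PowerSeries (LaurentRing I)) (n : ℕ) :
    PowerSeries.coeff n (coeffDerivation I f) = (PowerSeries.coeff n f).deriv :=
  PowerSeries.coeff_mk n fun n => (PowerSeries.coeff n f).deriv

/-- The power series `w(t + X) - w(t)`. -/
def taylorDiff (w : LaurentRing I) : PowerSeries (LaurentRing I) :=
  PowerSeries.mk fun i => if i = 0 then 0 else divDeriv i w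

theorem coeff_taylorDiff_pow_of_lt (w : LaurentRing I) {j l : ℕ} (h : j < l) :
    PowerSeries.coeff j (taylorDiff w ^ l) = 0 := by
  have h1 : PowerSeries.X ∣ taylorDiff w := by
    rw [PowerSeries.X_dvd_iff, ← PowerSeries.coeff_zero_eq_constantCoeff_apply]
    simp [taylorDiff]
  exact PowerSeries.X_pow_dvd_iff.mp (pow_dvd_pow_of_dvd h1 l) j h

/-- The hypothesis says that `X ↦ w(t + X) - w(t)` sends the disc of radius `β'` into the disc of
radius `β`. Powers are then bounded by `β ^ l`, by submultiplicativity of the norm. -/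
theorem gaussNorm_coeff_taylorDiff_pow_le (w : LaurentRing I) {r β β' : ℝ} (hr : r ∈ I.carrier)
    (hβ : 0 ≤ β) (hβ' : 0 < β') (h : ∀ i ≠ 0, gaussNorm r (divDeriv i w) * β' ^ i ≤ β)
    (j l : ℕ) : gaussNorm r (PowerSeries.coeff j (taylorDiff w ^ l)) * β' ^ j ≤ β ^ l := by
  have h0 : ∀ i, gaussNorm r (PowerSeries.coeff i (taylorDiff w)) * β' ^ i ≤ β := by
    intro i
    rw [taylorDiff, PowerSeries.coeff_mk]
    split_ifs with hi
    · rw [gaussNorm_zero, zero_mul]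
      exact hβ
    · exact h i hi
  induction l generalizing j with
  | zero =>
    rw [pow_zero, pow_zero, PowerSeries.coeff_one]
    split_ifs with hj
    · rw [hj, pow_zero, mul_one]
      exact gaussNorm_one_le
    · rw [gaussNorm_zero, zero_mul]
      exact zero_le_one
  | succ l ih =>
    rw [pow_succ, PowerSeries.coeff_mul, ← le_div_iff₀ (pow_pos hβ' j)]
    refine gaussNorm_sum_le _ _ hr (by positivity) fun x hx => ?_
    rw [le_div_iff₀ (pow_pos hβ' j), ← Finset.HasAntidiagonal.mem_antidiagonal.mp hx, pow_add,
      pow_succ]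
    have h1 := gaussNorm_nonneg (PowerSeries.coeff x.2 (taylorDiff w)) hr
    refine (mul_le_mul_of_nonneg_right (gaussNorm_mul_le _ _ hr) (by positivity)).trans ?_
    rw [mul_mul_mul_comm]
    exact mul_le_mul (ih x.1) (h0 x.2) (by positivity) (by positivity)

variable [CharZero K]

/-- For `T = w(t + X) - w(t)` one has `∂T/∂t = ∂T/∂X - w'(t)`; both derivations are then applied to
`T ^ l`. For `l = 0` the truncated exponent `l - 1` does not matter, as its term has the factor `l`.
-/
theorem deriv_coeff_taylorDiff_pow (w : LaurentRing I) (j l : ℕ) :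
    (PowerSeries.coeff j (taylorDiff w ^ l)).deriv
      = ((j + 1 : ℕ) : LaurentRing I) * PowerSeries.coeff (j + 1) (taylorDiff w ^ l)
        - (l : LaurentRing I) * w.deriv * PowerSeries.coeff j (taylorDiff w ^ (l - 1)) := by
  have h1 : coeffDerivation I (taylorDiff w)
      = PowerSeries.derivative (LaurentRing I) (taylorDiff w) - PowerSeries.C w.deriv := by
    ext1 n
    rw [coeff_coeffDerivation, map_sub, PowerSeries.coeff_derivative, PowerSeries.coeff_C,
      taylorDiff, PowerSeries.coeff_mk, PowerSeries.coeff_mk, if_neg (Nat.succ_ne_zero n)]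
    split_ifs with hn
    · subst hn
      rw [← derivation_apply, map_zero]
      simp [divDeriv]
    · rw [deriv_divDeriv]
      push_cast
      ring
  have h2 := congrArg (PowerSeries.coeff j)
    (Derivation.leibniz_pow (coeffDerivation I) (taylorDiff w) l)
  rw [coeff_coeffDerivation, h1] at h2
  have h3 := congrArg (PowerSeries.coeff j)
    (Derivation.leibniz_pow (PowerSeries.derivative (LaurentRing I)) (taylorDiff w) l)
  rw [PowerSeries.coeff_derivative] at h3
  rw [h2, smul_sub, smul_sub, map_sub, ← h3, nsmul_eq_mul, smul_eq_mul,
    ← map_natCast (PowerSeries.C (R := LaurentRing I)),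
    PowerSeries.coeff_C_mul, PowerSeries.coeff_mul_C]
  push_cast
  ring

end LaurentRing

/-! ### The chain rule for horizontal maps, and an initial radius of convergence. -/

namespace NablaModule

open LaurentRing

variable {K : Type u} [NormedField K] [IsUltrametricDist K] [CompleteSpace K] [CharZero K]
  {X : AlignedInterval K} {E : NablaModule.{u, v} X} {I J : ClosedSub X}
  {φ : LaurentRing J.toAlignedInterval →+* LaurentRing I.toAlignedInterval}
  {F : E.obj J →ₛₗ[φ] E.obj I} {w : LaurentRing I.toAlignedInterval}

/-- The Taylor series of a pullback of a section. -/
theorem divD_map (hF : ∀ v, E.D I (F v) = w.deriv • F (E.D J v)) (v : E.obj J) (j N : ℕ)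
    (hN : j < N) : E.divD I j (F v)
      = ∑ l ∈ Finset.range N, PowerSeries.coeff j (taylorDiff w ^ l) • F (E.divD J l v) := by
  induction j generalizing N with
  | zero =>
    rw [Finset.sum_eq_single_of_mem 0 (Finset.mem_range.mpr hN)]
    · simp [divD_zero]
    · intro l _ hl
      rw [coeff_taylorDiff_pow_of_lt w (Nat.pos_of_ne_zero hl), zero_smul]
  | succ j ih =>
    refine natCast_smul_cancel (Nat.succ_ne_zero j) ?_
    rw [← D_divD, ih N (by omega), map_sum, Finset.smul_sum]
    -- Differentiating a summand yields the summand for `j + 1`, times `j + 1`, plus a telescoping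
    -- difference `a (l + 1) - a l`. The boundary terms vanish: `a 0` has the factor `0`, and `a N`
    -- involves the coefficient of `X ^ j` in a power `> j` of a series divisible by `X`.
    set a : ℕ → E.obj I := fun l => ((l : LaurentRing I.toAlignedInterval) * w.deriv *
      PowerSeries.coeff j (taylorDiff w ^ (l - 1))) • F (E.divD J l v) with ha
    have hterm : ∀ l, E.D I (PowerSeries.coeff j (taylorDiff w ^ l) • F (E.divD J l v))
        = ((j + 1 : ℕ) : LaurentRing I.toAlignedInterval) •
          PowerSeries.coeff (j + 1) (taylorDiff w ^ l) • F (E.divD J l v) + (a (l + 1) - a l) := by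
      intro l
      rw [E.leibniz, deriv_coeff_taylorDiff_pow, hF, D_divD, F.map_smulₛₗ, map_natCast, ha]
      simp only [Nat.add_sub_cancel]
      module
    have ha0 : a 0 = 0 := by simp [ha]
    have haN : a N = 0 := by
      rw [ha]
      simp only
      rw [coeff_taylorDiff_pow_of_lt w (by omega), mul_zero, zero_smul]
    rw [Finset.sum_congr rfl fun l _ => hterm l, Finset.sum_add_distrib, Finset.sum_range_sub, ha0,
      haN, sub_zero, add_zero]

/-- If `F` is a horizontal map along `t ↦ w(t)`, which sends discs of radius `β'` into discs of
radius `β`, then boundedness of Taylor series on discs of radius `β` implies the boundedness of the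
Taylor series of the pullback on discs of radius `β'`. -/
theorem IsTaylorBounded.map {β β' : ℝ} (hβ : 0 < β) (hβ' : 0 < β') (hJ : E.IsTaylorBounded J β)
    (hI : ∀ r ∈ I.carrier, β' ≤ r) (hbc : IsBaseChangeAlong φ F)
    (hF : ∀ v, E.D I (F v) = w.deriv • F (E.D J v)) {M : ℝ} (hM : 0 ≤ M)
    (hφ : ∀ f, ∀ r ∈ I.carrier, ∃ r' ∈ J.carrier, gaussNorm r (φ f) ≤ M * gaussNorm r' f)
    (hw : ∀ r ∈ I.carrier, ∀ i ≠ 0, gaussNorm r (divDeriv i w) * β' ^ i ≤ β) :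
    E.IsTaylorBounded I β' := by
  obtain ⟨m, e, he⟩ := exists_generators E J
  refine isTaylorBounded_of_span hβ' hI (hbc.span_eq_top he) fun i l => ?_
  obtain ⟨B, hB, hb⟩ := (hJ (e i)).map hβ F hM hφ l
  refine ⟨B, hB, fun j r hr => ?_⟩
  change gaussNorm r (l (E.divD I j (F (e i)))) * β' ^ j ≤ B
  -- The sum may be cut off at any length exceeding `j`. By the ultrametric inequality it is enough
  -- to bound each summand: the factor `β' ^ j` turns the Taylor difference into `β ^ k`, which the
  -- bounded sequence absorbs.
  rw [divD_map hF (e i) j (j + 1) (Nat.lt_succ_self j), map_sum, ← le_div_iff₀ (pow_pos hβ' j)]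
  refine gaussNorm_sum_le _ _ hr (by positivity) fun k _ => ?_
  rw [le_div_iff₀ (pow_pos hβ' j), map_smul, smul_eq_mul]
  have h1 := gaussNorm_coeff_taylorDiff_pow_le w hr hβ.le hβ' (hw r hr) j k
  have h2 := gaussNorm_nonneg (l (F (E.divD J k (e i)))) hr
  calc _ ≤ gaussNorm r (PowerSeries.coeff j (taylorDiff w ^ k)) *
        gaussNorm r (l (F (E.divD J k (e i)))) * β' ^ j :=
        mul_le_mul_of_nonneg_right (gaussNorm_mul_le _ _ hr) (by positivity)
    _ = gaussNorm r (PowerSeries.coeff j (taylorDiff w ^ k)) * β' ^ j *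
        gaussNorm r (l (F (E.divD J k (e i)))) := by ring
    _ ≤ β ^ k * gaussNorm r (l (F (E.divD J k (e i)))) := mul_le_mul_of_nonneg_right h1 h2
    _ = gaussNorm r (l (F (E.divD J k (e i)))) * β ^ k := mul_comm _ _
    _ ≤ B := hb k r hr

/-- Over any closed annulus, the Taylor series have a positive radius of convergence. -/
theorem exists_isTaylorBounded {p : ℕ} [Fact p.Prime] [Fact (‖(p : K)‖ = (p : ℝ)⁻¹)]
    (E : NablaModule.{u, v} X) (I : ClosedSub X) :
    ∃ β, 0 < β ∧ (∀ r ∈ I.carrier, β ≤ r) ∧ E.IsTaylorBounded I β := by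
  obtain ⟨m, e, he⟩ := exists_generators E I
  obtain ⟨c, hc⟩ := I.isCompact.exists_isLeast I.nonempty
  have hc0 : 0 < c := I.pos hc.1
  have hp1 : 1 < (p : ℝ) := by exact_mod_cast (Fact.out : p.Prime).one_lt
  have hp0 : 0 < (p : ℝ) := by linarith
  have := E.projective I
  obtain ⟨l, hl⟩ := exists_dual_of_span_eq_top he
  choose A hA0 hA using fun i k => exists_gaussNorm_le (l k (E.D I (e i))) I.isCompact
  -- `B` dominates both the matrix of the connection in terms of `e` and the norm of `d/dt` on
  -- functions, which is at most `c⁻¹` since `c` is the smallest radius. Hence `D^j` has norm at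
  -- most `B ^ j`.
  obtain ⟨B, hB0, hBc, hBA⟩ : ∃ B : ℝ, 0 < B ∧ c⁻¹ ≤ B ∧ ∀ i k, A i k ≤ B := by
    refine ⟨c⁻¹ + ∑ i, ∑ k, A i k, ?_, ?_, fun i k => ?_⟩
    · have := Finset.sum_nonneg fun i (_ : i ∈ Finset.univ) =>
        Finset.sum_nonneg fun k (_ : k ∈ Finset.univ) => hA0 i k
      positivity
    · have := Finset.sum_nonneg fun i (_ : i ∈ Finset.univ) =>
        Finset.sum_nonneg fun k (_ : k ∈ Finset.univ) => hA0 i k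
      linarith
    · have h1 := Finset.single_le_sum (fun k _ => hA0 i k) (Finset.mem_univ k)
      have h2 := Finset.single_le_sum (f := fun i => ∑ k, A i k)
        (fun i _ => Finset.sum_nonneg fun k _ => hA0 i k) (Finset.mem_univ i)
      have h3 := inv_pos.mpr hc0
      linarith
  have key : ∀ i j, ∃ a : Fin m → LaurentRing I.toAlignedInterval,
      (E.D I)^[j] (e i) = ∑ k, a k • e k ∧ ∀ k, ∀ r ∈ I.carrier, gaussNorm r (a k) ≤ B ^ j := by
    intro i j
    induction j with
    | zero =>
      refine ⟨Pi.single i 1, by simp [Pi.single_apply, ite_smul], fun k r hr => ?_⟩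
      rw [Pi.single_apply]
      split_ifs
      · simpa using gaussNorm_one_le
      · simp [gaussNorm_zero]
    | succ j ih =>
      obtain ⟨a, ha, hab⟩ := ih
      refine ⟨fun k => (a k).deriv + ∑ k', a k' * l k (E.D I (e k')), ?_, fun k r hr => ?_⟩
      · rw [Function.iterate_succ_apply', ha, map_sum]
        simp only [E.leibniz, add_smul, Finset.sum_add_distrib, Finset.sum_smul]
        congr 1
        rw [Finset.sum_comm]
        refine Finset.sum_congr rfl fun k' _ => ?_
        conv_lhs => rw [hl (E.D I (e k'))]
        rw [Finset.smul_sum]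
        exact Finset.sum_congr rfl fun k _ => smul_smul _ _ _
      · have hr0 := I.pos hr
        rw [pow_succ]
        refine (gaussNorm_add_le _ _ hr).trans (max_le ?_ (gaussNorm_sum_le _ _ hr
          (by positivity) fun k' _ => (gaussNorm_mul_le _ _ hr).trans (mul_le_mul (hab k' r hr)
          ((hA k' k r hr).trans (hBA k' k)) (gaussNorm_nonneg _ hr) (by positivity))))
        have h1 := gaussNorm_divDeriv_le 1 (a k) hr
        have h2 : divDeriv 1 (a k) = (a k).deriv := by simp [divDeriv]
        rw [h2, pow_one, ← le_div_iff₀ hr0, div_eq_mul_inv] at h1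
        exact h1.trans (mul_le_mul (hab k r hr)
          ((inv_anti₀ hc0 (hc.2 hr)).trans hBc) (by positivity) (by positivity))
  -- The factor `p` compensates for `|1/j!| ≤ p ^ j`, and the bound by `c` is what the reduction to
  -- generators requires.
  have hβ : 0 < min c (B * p)⁻¹ := lt_min hc0 (by positivity)
  refine ⟨min c (B * p)⁻¹, hβ, fun r hr => (min_le_left _ _).trans (hc.2 hr),
    isTaylorBounded_of_span hβ (fun r hr => (min_le_left _ _).trans (hc.2 hr)) he fun i => ?_⟩
  choose a ha hab using key i
  refine isBoundedSeq_of_span hβ (e := e) (c := fun j k => C ((j.factorial : K)⁻¹) * a j k)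
    (fun j => ?_) fun k => ⟨1, zero_le_one, fun j r hr => ?_⟩
  · rw [divD, ha, Finset.smul_sum]
    exact Finset.sum_congr rfl fun k _ => smul_smul _ _ _
  · have hC : gaussNorm r (C ((j.factorial : K)⁻¹) : LaurentRing I.toAlignedInterval) ≤ (p : ℝ) ^ j := by
      refine (gaussNorm_monomial_le hr 0 ((j.factorial : K)⁻¹)).trans ?_
      rw [zpow_zero, mul_one]
      exact norm_factorial_inv_le j
    have h1 : gaussNorm r (C ((j.factorial : K)⁻¹) * a j k) ≤ (p : ℝ) ^ j * B ^ j :=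
      (gaussNorm_mul_le _ _ hr).trans (mul_le_mul hC (hab j k r hr) (gaussNorm_nonneg _ hr)
        (by positivity))
    calc _ ≤ (p : ℝ) ^ j * B ^ j * ((B * p)⁻¹) ^ j :=
          mul_le_mul h1 (pow_le_pow_left₀ hβ.le (min_le_right _ _) j) (by positivity)
            (by positivity)
      _ = 1 := by
        rw [← mul_pow, ← mul_pow, mul_comm (p : ℝ), mul_inv_cancel₀ (by positivity), one_pow]

end NablaModule

/-- The logarithmic radii at the points `x_0 / q ^ k`: a bounded concave function whose value
improves under division of the argument by `q` tends to zero. -/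
theorem eventually_neg_mem_of_concave {S : ℕ → Set ℝ} {q : ℕ} (hq : 2 ≤ q) {x L : ℝ} (hx : 0 < x)
    (hL : 0 < L) (h0 : ∀ k, ∀ y ∈ S k, y ≤ 0) (hne : ∀ k, (S k).Nonempty)
    (hdown : ∀ k, ∀ y ∈ S k, ∀ y' ≤ y, y' ∈ S k)
    (hF : ∀ M : ℕ, ∀ᶠ k in atTop, ∀ y ∈ S k, ∀ y', y' ≤ y / q → y' ≤ y + L →
      y' ≤ y + M * (x / q ^ (k + 1)) → y' ∈ S (k + 1))
    (hconc : ∀ k, ∀ y₀ ∈ S k, ∀ y₂ ∈ S (k + 2), (q * y₂ + y₀) / (q + 1) ∈ S (k + 1))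
    {ε : ℝ} (hε : 0 < ε) : ∀ᶠ k in atTop, -ε ∈ S k := by
  have hq1 : (1 : ℝ) < q := by exact_mod_cast hq
  have hq0 : (0 : ℝ) < q := by linarith
  have hbdd : ∀ k, BddAbove (S k) := fun k => ⟨0, fun y hy => h0 k y hy⟩
  set r : ℕ → ℝ := fun k => sSup (S k) with hr
  -- Concavity: `x / q ^ (k + 1)` is the mean of `x / q ^ (k + 2)` and `x / q ^ k` with weights `q`
  -- and `1`. Consequently each increment is at most `1 / q` times the preceding one. The suprema
  -- need not be attained; a slack of `δ / (q + 1)` in each adds up to `δ`.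
  have hc : ∀ k, q * (r (k + 2) - r (k + 1)) ≤ r (k + 1) - r k := by
    intro k
    refine le_of_forall_pos_sub_le fun δ hδ => ?_
    have hδ' : 0 < δ / (q + 1) := by positivity
    obtain ⟨y₀, hy₀, hy₀'⟩ := exists_lt_of_lt_csSup (hne k) (sub_lt_self (r k) hδ')
    obtain ⟨y₂, hy₂, hy₂'⟩ := exists_lt_of_lt_csSup (hne (k + 2)) (sub_lt_self (r (k + 2)) hδ')
    have h1 := le_csSup (hbdd (k + 1)) (hconc k y₀ hy₀ y₂ hy₂)
    rw [div_le_iff₀ (by positivity)] at h1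
    have h2 : δ / (q + 1) * (q + 1) = δ := div_mul_cancel₀ δ (by positivity)
    change q * y₂ + y₀ ≤ r (k + 1) * (q + 1) at h1
    nlinarith
  set D : ℝ := |r 1 - r 0| with hD
  have hd : ∀ k, r (k + 1) - r k ≤ D / q ^ k := by
    intro k
    induction k with
    | zero => simpa using le_abs_self (r 1 - r 0)
    | succ k ih =>
      rw [pow_succ, ← div_div, le_div_iff₀ hq0, mul_comm]
      exact (hc k).trans ih
  -- With this `M`, the increment bound `D / q ^ k` is smaller than `M * (x / q ^ (k + 1))` for
  -- every `k`.
  obtain ⟨M, hM⟩ := exists_nat_gt (q * D / x)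
  rw [div_lt_iff₀ hx] at hM
  have hlim : Tendsto (fun k : ℕ => D / (q : ℝ) ^ k) atTop (𝓝 0) :=
    tendsto_const_nhds.div_atTop (tendsto_pow_atTop_atTop_of_one_lt hq1)
  -- If `r (k + 1) < r k / q`, then some `y` close to `r k` makes all three upper limits on `y'`
  -- exceed `r (k + 1)`, the two additive ones because the increment is small. The minimum of the
  -- three would then be an element of `S (k + 1)` above its supremum.
  have hstep : ∀ᶠ k in atTop, r k / q ≤ r (k + 1) := by
    filter_upwards [hF M, hlim.eventually_lt_const hL] with k hk hkL
    by_contra! hlt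
    have hqk : (0 : ℝ) < q ^ k := pow_pos hq0 k
    have h3 : D / q ^ k < M * (x / q ^ (k + 1)) := by
      rw [pow_succ, ← mul_div_assoc, div_lt_div_iff₀ hqk (by positivity)]
      nlinarith
    have h4 : max (q * r (k + 1)) (max (r (k + 1) - L) (r (k + 1) - M * (x / q ^ (k + 1))))
        < r k := by
      have := hd k
      rw [lt_div_iff₀ hq0] at hlt
      refine max_lt (by linarith) (max_lt (by linarith) (by linarith))
    obtain ⟨y, hy, hy'⟩ := exists_lt_of_lt_csSup (hne k) h4
    rw [max_lt_iff, max_lt_iff] at hy'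
    have h5 := hk y hy (min (y / q) (min (y + L) (y + M * (x / q ^ (k + 1)))))
      (min_le_left _ _) ((min_le_right _ _).trans (min_le_left _ _))
      ((min_le_right _ _).trans (min_le_right _ _))
    have h6 := le_csSup (hbdd (k + 1)) h5
    refine absurd h6 (not_le.mpr ?_)
    change r (k + 1) < _
    rw [lt_min_iff, lt_min_iff, lt_div_iff₀ hq0]
    refine ⟨by linarith [hy'.1], by linarith [hy'.2.1], by linarith [hy'.2.2]⟩
  obtain ⟨k₀, hk₀⟩ := eventually_atTop.mp hstep
  have hgeom : ∀ i, r k₀ / q ^ i ≤ r (k₀ + i) := by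
    intro i
    induction i with
    | zero => simp
    | succ i ih =>
      rw [pow_succ, ← div_div]
      exact (div_le_div_of_nonneg_right ih hq0.le).trans (hk₀ (k₀ + i) (Nat.le_add_right _ _))
  have hlim2 : Tendsto (fun i : ℕ => r k₀ / (q : ℝ) ^ i) atTop (𝓝 0) :=
    tendsto_const_nhds.div_atTop (tendsto_pow_atTop_atTop_of_one_lt hq1)
  obtain ⟨i₀, hi₀⟩ := eventually_atTop.mp (hlim2.eventually_const_lt (neg_neg_of_pos hε))
  refine eventually_atTop.mpr ⟨k₀ + i₀, fun k hk => ?_⟩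
  obtain ⟨i, rfl⟩ := Nat.exists_eq_add_of_le ((Nat.le_add_right _ _).trans hk)
  obtain ⟨y, hy, hy'⟩ := exists_lt_of_lt_csSup (hne (k₀ + i))
    ((hi₀ i (by omega)).trans_le (hgeom i))
  exact hdown _ y hy _ hy'.le

/-! ### Estimates for a function close to `t ^ q` on a circle. -/

namespace LaurentRing

variable {K : Type u} [NormedField K] [IsUltrametricDist K] [CompleteSpace K]
  {I : AlignedInterval K}

theorem divDeriv_add (j : ℕ) (f g : LaurentRing I) :
    divDeriv j (f + g) = divDeriv j f + divDeriv j g := by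
  rw [divDeriv, divDeriv, divDeriv, ← mul_add]
  congr 1
  exact iterate_map_add (derivation I) j f g

theorem gaussNorm_le_of_sub_monomial {w : LaurentRing I} {r : ℝ} {q : ℕ} (hr : r ∈ I.carrier)
    (h : gaussNorm r (w - monomial (q : ℤ) 1) < r ^ q) : gaussNorm r w ≤ r ^ q := by
  rw [← sub_add_cancel w (monomial (q : ℤ) 1)]
  refine (gaussNorm_add_le _ _ hr).trans (max_le h.le ?_)
  simpa using gaussNorm_monomial_le hr (q : ℤ) (1 : K)

/-- With `g = w - t^q` one has `w⁻¹ = t^(-q) (1 - g w⁻¹)`. As `|g| < r^q`, the term `g w⁻¹` cannot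
dominate on the right, which leaves `|w⁻¹| ≤ r^(-q)`. Only submultiplicativity of the norm is
needed. -/
theorem gaussNorm_inv_le_of_sub_monomial {w : (LaurentRing I)ˣ} {r : ℝ} {q : ℕ}
    (hr : r ∈ I.carrier)
    (h : gaussNorm r ((w : LaurentRing I) - monomial (q : ℤ) 1) < r ^ q) :
    gaussNorm r ((w⁻¹ : (LaurentRing I)ˣ) : LaurentRing I) ≤ (r ^ q)⁻¹ := by
  have hr0 := I.pos hr
  have hrq : 0 < r ^ q := pow_pos hr0 q
  have hm : (monomial (-(q : ℤ)) 1 : LaurentRing I) * monomial (q : ℤ) 1 = 1 := by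
    ext i
    rw [coeff_monomial_mul, coeff_monomial, coeff_one, one_mul]
    congr 1
    exact propext ⟨fun h => by omega, fun h => by omega⟩
  have hv : ((w⁻¹ : (LaurentRing I)ˣ) : LaurentRing I) = monomial (-(q : ℤ)) 1 *
      (1 + -(((w : LaurentRing I) - monomial (q : ℤ) 1) *
        ((w⁻¹ : (LaurentRing I)ˣ) : LaurentRing I))) := by
    have h1 := w.mul_inv
    linear_combination (-((w⁻¹ : (LaurentRing I)ˣ) : LaurentRing I)) * hm +
      (monomial (-(q : ℤ)) 1 : LaurentRing I) * h1
  set v := ((w⁻¹ : (LaurentRing I)ˣ) : LaurentRing I)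
  set g := (w : LaurentRing I) - monomial (q : ℤ) 1
  have hneg : gaussNorm r (-(g * v)) = gaussNorm r (g * v) := by
    simp only [gaussNorm, coeff_neg, norm_neg]
  have hmn : gaussNorm r (monomial (-(q : ℤ)) 1 : LaurentRing I) ≤ (r ^ q)⁻¹ := by
    have := gaussNorm_monomial_le hr (-(q : ℤ)) (1 : K)
    rwa [norm_one, one_mul, zpow_neg, zpow_natCast] at this
  by_contra! hlt
  have h2 : gaussNorm r v ≤ (r ^ q)⁻¹ * max 1 (gaussNorm r g * gaussNorm r v) := by
    conv_lhs => rw [hv]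
    refine (gaussNorm_mul_le _ _ hr).trans (mul_le_mul hmn ?_ (gaussNorm_nonneg _ hr)
      (by positivity))
    refine (gaussNorm_add_le _ _ hr).trans (max_le_max gaussNorm_one_le ?_)
    rw [hneg]
    exact gaussNorm_mul_le _ _ hr
  have hv0 : 0 < gaussNorm r v := (inv_pos.mpr hrq).trans hlt
  rcases le_total (gaussNorm r g * gaussNorm r v) 1 with h3 | h3
  · rw [max_eq_left h3, mul_one] at h2
    linarith
  · rw [max_eq_right h3, ← div_eq_inv_mul, le_div_iff₀ hrq] at h2
    nlinarith

variable [CharZero K] {p n : ℕ} [Fact p.Prime] [Fact (‖(p : K)‖ = (p : ℝ)⁻¹)]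

/-- Here `t` and `b` are radii relative to the circles `r` and `r ^ q`. The three hypotheses
correspond to the terms of `w(t + X) - w(t)`: `hb` to `X ^ q`, `hp` to the intermediate terms of the
binomial expansion, whose coefficients are divisible by `p`, and `hg` to the error `w - t ^ q`. For
the last two, `t ^ i ≤ t` reduces everything to the first power. -/
theorem gaussNorm_divDeriv_mul_le {w : LaurentRing I} {r t b : ℝ} (hr : r ∈ I.carrier)
    (ht0 : 0 < t) (ht1 : t ≤ 1) (hb : t ^ (p ^ n) ≤ b) (hp : (p : ℝ)⁻¹ * t ≤ b)
    (hg : gaussNorm r (w - monomial ((p ^ n : ℕ) : ℤ) 1) * t ≤ r ^ (p ^ n) * b)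
    {i : ℕ} (hi : i ≠ 0) : gaussNorm r (divDeriv i w) * (r * t) ^ i ≤ r ^ (p ^ n) * b := by
  have hr0 := I.pos hr
  have hti : t ^ i ≤ t := pow_le_of_le_one ht0.le ht1 hi
  rw [← le_div_iff₀ (by positivity), ← sub_add_cancel w (monomial ((p ^ n : ℕ) : ℤ) 1), divDeriv_add]
  refine (gaussNorm_add_le _ _ hr).trans (max_le ?_ ?_)
  · rw [le_div_iff₀ (by positivity), mul_pow, ← mul_assoc]
    exact (mul_le_mul (gaussNorm_divDeriv_le i _ hr) hti (by positivity)
      (gaussNorm_nonneg _ hr)).trans hg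
  · rw [le_div_iff₀ (by positivity), divDeriv_monomial]
    refine (mul_le_mul_of_nonneg_right (gaussNorm_monomial_le hr _ _) (by positivity)).trans ?_
    have h1 : r ^ (((p ^ n : ℕ) : ℤ) - i) * r ^ i = r ^ (p ^ n) := by
      rw [← zpow_natCast, ← zpow_natCast, ← zpow_add₀ hr0.ne', sub_add_cancel]
    have h2 : ‖((p ^ n).choose i : K)‖ * t ^ i ≤ b := by
      by_cases hin : i = p ^ n
      · rw [hin, Nat.choose_self, Nat.cast_one, norm_one, one_mul]
        exact hb
      · exact (mul_le_mul (norm_choose_le hi hin) hti (by positivity) (by positivity)).trans hp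
    calc _ = r ^ (((p ^ n : ℕ) : ℤ) - i) * r ^ i * (‖((p ^ n).choose i : K)‖ * t ^ i) := by
          rw [mul_pow]
          ring
      _ ≤ r ^ (p ^ n) * b := by
          rw [h1]
          exact mul_le_mul_of_nonneg_left h2 (by positivity)

end LaurentRing

/-! ### Dependence of the radius of convergence on the annulus. -/

namespace NablaModule

open LaurentRing

variable {K : Type u} [NormedField K] [IsUltrametricDist K] [CompleteSpace K] [CharZero K]
  {X : AlignedInterval K} {E : NablaModule.{u, v} X} {I J : ClosedSub X} {β : ℝ}

theorem IsTaylorBounded.res (hβ : 0 < β) (h : I.toAlignedInterval ≤ J.toAlignedInterval)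
    (hI : ∀ r ∈ I.carrier, β ≤ r) (hJ : E.IsTaylorBounded J β) : E.IsTaylorBounded I β := by
  obtain ⟨m, e, he⟩ := exists_generators E J
  refine isTaylorBounded_of_span hβ hI ((E.res_isBaseChange h).span_eq_top he) fun i => ?_
  have := (hJ (e i)).res hβ h
  simpa only [divD_res] using this

theorem IsTaylorBounded.exists_bound_of_res (h : I.toAlignedInterval ≤ J.toAlignedInterval)
    (hI : E.IsTaylorBounded I β) (v : E.obj J)
    (l : E.obj J →ₗ[LaurentRing J.toAlignedInterval] LaurentRing J.toAlignedInterval) :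
    ∃ B : ℝ, 0 ≤ B ∧ ∀ j, ∀ r ∈ I.carrier, gaussNorm r (l (E.divD J j v)) * β ^ j ≤ B := by
  have h1 := hI (E.res h v)
  simp only [divD_res] at h1
  exact h1.exists_bound_of_res l

/-- The maximum principle for the radius of convergence of Taylor series. -/
theorem isTaylorBounded_of_endpoints {I₀ I₁ : ClosedSub X} {a b : ℝ} (hβ : 0 < β)
    (h₀ : I₀.toAlignedInterval ≤ J.toAlignedInterval)
    (h₁ : I₁.toAlignedInterval ≤ J.toAlignedInterval) (ha : a ∈ I₀.carrier) (hb : b ∈ I₁.carrier)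
    (hJ : ∀ r ∈ J.carrier, β ≤ r ∧ a ≤ r ∧ r ≤ b) (hI₀ : E.IsTaylorBounded I₀ β)
    (hI₁ : E.IsTaylorBounded I₁ β) : E.IsTaylorBounded J β := by
  obtain ⟨m, e, he⟩ := exists_generators E J
  refine isTaylorBounded_of_span hβ (fun r hr => (hJ r hr).1) he fun i l => ?_
  obtain ⟨B₀, hB₀, h₀'⟩ := hI₀.exists_bound_of_res h₀ (e i) l
  obtain ⟨B₁, hB₁, h₁'⟩ := hI₁.exists_bound_of_res h₁ (e i) l
  refine ⟨max B₀ B₁, le_max_of_le_left hB₀, fun j r hr => ?_⟩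
  refine (mul_le_mul_of_nonneg_right (gaussNorm_le_max _ (h₀ ha) (h₁ hb) (hJ r hr).2.1
    (hJ r hr).2.2) (pow_nonneg hβ.le j)).trans ?_
  rw [max_mul_of_nonneg _ _ (pow_nonneg hβ.le j)]
  exact max_le_max (h₀' j a ha) (h₁' j b hb)

/-- Log-concavity of the radius of convergence of Taylor series. -/
theorem isTaylorBounded_of_three_circles {I₀ I₁ I₂ : ClosedSub X} {a β₀ β₁ β₂ : ℝ} {q : ℕ}
    (h₀ : I₀.toAlignedInterval ≤ J.toAlignedInterval)
    (h₁ : I₁.toAlignedInterval ≤ J.toAlignedInterval)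
    (h₂ : I₂.toAlignedInterval ≤ J.toAlignedInterval) (ha₀ : a ^ (q ^ 2) ∈ I₀.carrier)
    (ha₁ : I₁.carrier = {a ^ q}) (ha₂ : a ∈ I₂.carrier) (hβ₀ : 0 < β₀) (hβ₁ : 0 < β₁)
    (hβ₂ : 0 < β₂) (hβ : β₁ ^ (q + 1) = β₂ ^ q * β₀) (hle : β₁ ≤ a ^ q)
    (hI₀ : E.IsTaylorBounded I₀ β₀) (hI₂ : E.IsTaylorBounded I₂ β₂) :
    E.IsTaylorBounded I₁ β₁ := by
  have ha₁' : a ^ q ∈ I₁.carrier := by rw [ha₁]; rfl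
  obtain ⟨m, e, he⟩ := exists_generators E J
  have := E.projective J
  obtain ⟨l, hl⟩ := exists_dual_of_span_eq_top he
  refine isTaylorBounded_of_span hβ₁ (fun r hr => ?_) ((E.res_isBaseChange h₁).span_eq_top he)
    fun i => ?_
  · rw [ha₁] at hr
    rw [Set.mem_singleton_iff.mp hr]
    exact hle
  -- The coordinates are taken over `J`, which contains all three circles, so that a single function
  -- can be compared on them.
  refine isBoundedSeq_of_span hβ₁ (e := fun k => E.res h₁ (e k))
    (c := fun j k => restrict h₁ (l k (E.divD J j (e i)))) (fun j => ?_) fun k => ?_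
  · rw [divD_res]
    conv_lhs => rw [hl (E.divD J j (e i))]
    rw [map_sum]
    exact Finset.sum_congr rfl fun k _ => (E.res h₁).map_smulₛₗ _ _
  · obtain ⟨B₀, hB₀, h₀'⟩ := hI₀.exists_bound_of_res h₀ (e i) (l k)
    obtain ⟨B₂, hB₂, h₂'⟩ := hI₂.exists_bound_of_res h₂ (e i) (l k)
    refine ⟨max B₀ B₂, le_max_of_le_left hB₀, fun j r hr => ?_⟩
    rw [ha₁] at hr
    rw [Set.mem_singleton_iff.mp hr]
    set f := l k (E.divD J j (e i))
    change gaussNorm (a ^ q) f * β₁ ^ j ≤ _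
    refine le_of_pow_le_pow_left₀ (Nat.succ_ne_zero q) (le_max_of_le_left hB₀) ?_
    have h3 := gaussNorm_three_circles f (h₀ ha₀) (h₁ ha₁') (h₂ ha₂)
    have h4 := gaussNorm_nonneg f (h₀ ha₀)
    have h5 := gaussNorm_nonneg f (h₂ ha₂)
    calc (gaussNorm (a ^ q) f * β₁ ^ j) ^ (q + 1)
        = gaussNorm (a ^ q) f ^ (q + 1) * (β₁ ^ (q + 1)) ^ j := by ring
      _ ≤ gaussNorm a f ^ q * gaussNorm (a ^ (q ^ 2)) f * (β₂ ^ q * β₀) ^ j := by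
        rw [hβ]
        exact mul_le_mul_of_nonneg_right h3 (by positivity)
      _ = (gaussNorm a f * β₂ ^ j) ^ q * (gaussNorm (a ^ (q ^ 2)) f * β₀ ^ j) := by ring
      _ ≤ (max B₀ B₂) ^ q * max B₀ B₂ := by
        have h6 := (h₂' j a ha₂).trans (le_max_right B₀ B₂)
        have h7 := (h₀' j _ ha₀).trans (le_max_left B₀ B₂)
        gcongr
      _ = (max B₀ B₂) ^ (q + 1) := (pow_succ _ _).symm

/-- Passing from `β` to the smaller `η` gains the geometric factor `(η / β) ^ j`. -/
theorem IsTaylorBounded.isEtaNull (h : E.IsTaylorBounded I β) {η : ℝ} (hη : 0 < η) (hηβ : η < β)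
    (v : E.obj I) : E.IsEtaNull I η fun j => E.divD I j v := by
  intro m e he
  have := E.projective I
  obtain ⟨l, hl⟩ := exists_dual_of_span_eq_top he
  refine ⟨fun j i => l i (E.divD I j v), fun j => hl _, fun ε hε => ?_⟩
  have hβ : 0 < β := hη.trans hηβ
  rw [eventually_all]
  intro i
  obtain ⟨B, hB, hb⟩ := h v (l i)
  have hlim : Tendsto (fun j : ℕ => B * (η / β) ^ j) atTop (𝓝 (B * 0)) :=
    (tendsto_pow_atTop_nhds_zero_of_lt_one (by positivity) ((div_lt_one hβ).mpr hηβ)).const_mul B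
  rw [mul_zero] at hlim
  filter_upwards [hlim.eventually_lt_const hε] with j hj r hr
  refine lt_of_le_of_lt ?_ hj
  have h1 : gaussNorm r (l i (E.divD I j v)) * η ^ j
      = gaussNorm r (l i (E.divD I j v)) * β ^ j * (η / β) ^ j := by
    rw [div_pow]
    field_simp
  rw [h1]
  exact mul_le_mul_of_nonneg_right (hb j r hr) (by positivity)

end NablaModule

/-- The closed annulus `c ≤ |t| ≤ d`. -/
def ClosedSub.icc {K : Type u} [NormedField K] {r : ℝ} {hr : r ∈ divValueGroup K} {hr1 : r < 1}
    {c d : ℝ} (hc : c ∈ divValueGroup K) (hd : d ∈ divValueGroup K) (hrc : r ≤ c) (hcd : c ≤ d)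
    (hd1 : d < 1) : ClosedSub (AlignedInterval.ico r hr hr1) where
  carrier := Set.Icc c d
  nonempty := ⟨c, le_rfl, hcd⟩
  ordConnected := Set.ordConnected_Icc
  subset := fun _ hx => ⟨hc.1.trans_le hx.1, hx.2.trans_lt hd1⟩
  least_mem := fun x hx => by
    rwa [hx.unique (isLeast_Icc hcd)]
  greatest_mem := fun x hx => by
    rwa [hx.unique (isGreatest_Icc hcd)]
  isCompact := isCompact_Icc
  le := fun _ hx => ⟨hrc.trans hx.1, hx.2.trans_lt hd1⟩

/-! ### The action of Frobenius on radii of convergence, and the conclusion. -/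

section Frobenius

open LaurentRing AlignedInterval

variable {K : Type u} [NormedField K] [IsUltrametricDist K] [CompleteSpace K] [CharZero K]
  {p n : ℕ} [Fact p.Prime] [Fact (‖(p : K)‖ = (p : ℝ)⁻¹)] {σK : BaseFrobenius K p n}
  {σ : FrobeniusLift σK} {r : ℝ} {hr : r ∈ divValueGroup K} {hr1 : r < 1}
  {E : NablaModule.{u, v} (ico r hr hr1)}

/-- A Frobenius structure carries boundedness of Taylor series from the circle of radius `a ^ q` to
the circle of radius `a`, if the latter is sufficiently close to `1`. -/
theorem FrobeniusStructure.isTaylorBounded (Φ : FrobeniusStructure σ E)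
    {I J : ClosedSub (ico r hr hr1)} {a t b : ℝ} (hI : I.carrier = {a}) (ha : Φ.s ≤ a)
    (hJ : J.carrier = {a ^ (p ^ n)}) (ht0 : 0 < t) (ht1 : t ≤ 1) (hb0 : t ^ (p ^ n) ≤ b)
    (hb : (p : ℝ)⁻¹ * t ≤ b)
    (hg : gaussNorm a ((σ.u : LaurentRing (ico σ.a σ.a_mem σ.a_lt))
      - monomial ((p ^ n : ℕ) : ℤ) 1) < a ^ (p ^ n))
    (hg' : gaussNorm a ((σ.u : LaurentRing (ico σ.a σ.a_mem σ.a_lt))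
      - monomial ((p ^ n : ℕ) : ℤ) 1) * t ≤ a ^ (p ^ n) * b)
    (h : E.IsTaylorBounded J (a ^ (p ^ n) * b)) : E.IsTaylorBounded I (a * t) := by
  have haI : a ∈ I.carrier := by rw [hI]; rfl
  have haJ : a ^ (p ^ n) ∈ J.carrier := by rw [hJ]; rfl
  have ha0 : 0 < a := I.pos haI
  have hle : I.toAlignedInterval ≤ ico Φ.s Φ.s_mem Φ.s_lt := by
    intro x hx
    have hx' : x ∈ ({a} : Set ℝ) := hI ▸ hx
    rw [Set.mem_singleton_iff.mp hx']
    exact ⟨ha, (I.subset haI).2⟩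
  have hI' := le_trans' hle Φ.le_dom
  have hsub : gaussNorm a ((σ.uOn hI' : LaurentRing I.toAlignedInterval)
      - monomial ((p ^ n : ℕ) : ℤ) 1) = gaussNorm a ((σ.u : LaurentRing (ico σ.a σ.a_mem σ.a_lt))
      - monomial ((p ^ n : ℕ) : ℤ) 1) := rfl
  have hw := gaussNorm_le_of_sub_monomial haI (hsub.trans_lt hg)
  have hw' := gaussNorm_inv_le_of_sub_monomial haI (hsub.trans_lt hg)
  -- On the circle `|t| = a` the bounds for `u` and for `u⁻¹` match, so this circle goes into the
  -- circle of radius `a ^ q`.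
  have hm : MapsInto (σ.uOn hI') J.toAlignedInterval := by
    intro x hx
    have hx' : x ∈ ({a} : Set ℝ) := hI ▸ hx
    rw [Set.mem_singleton_iff.mp hx']
    exact ⟨⟨_, haJ, hw⟩, _, haJ, hw'⟩
  have hb1 : 0 < b := (pow_pos ht0 _).trans_le hb0
  refine h.map (by positivity) (by positivity) (fun x hx => ?_) (Φ.isBaseChange I J hle hm)
    (Φ.horizontal I J hle hm) (M := 2) (by norm_num) (fun f x hx => ?_) (fun x hx i hi => ?_)
  all_goals
    have hx' : x ∈ ({a} : Set ℝ) := hI ▸ hx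
    rw [Set.mem_singleton_iff.mp hx']
  · exact mul_le_of_le_one_right ha0.le ht1
  · exact ⟨_, haJ, gaussNorm_pullback_le σK.norm_le _ hm f haI haJ hw hw'⟩
  · exact gaussNorm_divDeriv_mul_le haI ht0 ht1 hb0 hb (by rw [hsub]; exact hg') hi

/-- For a Frobenius structure with `s = exp (-x)`, the Taylor series on the circle
`|t| = exp (-x / q ^ k)` have a radius of convergence close to `1` as `k → ∞`. -/
theorem FrobeniusStructure.eventually_isTaylorBounded (Φ : FrobeniusStructure σ E) (hn : 0 < n)
    {x : ℝ} (hx : 0 < x) (I : ℕ → ClosedSub (ico r hr hr1))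
    (hI : ∀ k, (I k).carrier = {Real.exp (-(x / ((p ^ n : ℕ) : ℝ) ^ k))})
    (hs : Φ.s = Real.exp (-x)) {ε : ℝ} (hε : 0 < ε) :
    ∀ᶠ k in atTop, E.IsTaylorBounded (I k) (Real.exp (-(x / ((p ^ n : ℕ) : ℝ) ^ k) - ε)) := by
  have hp1 : 1 < (p : ℝ) := by exact_mod_cast (Fact.out : p.Prime).one_lt
  have hp0 : 0 < (p : ℝ) := by linarith
  have hq : 2 ≤ p ^ n := (Fact.out : p.Prime).two_le.trans (Nat.le_self_pow hn.ne' p)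
  set q := p ^ n with hqdef
  have hq1 : (1 : ℝ) < q := by exact_mod_cast hq
  have hq0 : (0 : ℝ) < q := by linarith
  set a : ℕ → ℝ := fun k => Real.exp (-(x / (q : ℝ) ^ k)) with ha
  have ha0 : ∀ k, 0 < a k := fun k => Real.exp_pos _
  have haq : ∀ k, a (k + 1) ^ q = a k := fun k => by
    rw [ha, ← Real.exp_nat_mul, pow_succ]
    congr 1
    field_simp
  have hmono : Monotone a := monotone_nat_of_le_succ fun k => by
    have h1 : x / (q : ℝ) ^ (k + 1) ≤ x / (q : ℝ) ^ k :=
      div_le_div_of_nonneg_left hx.le (by positivity) (pow_le_pow_right₀ hq1.le k.le_succ)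
    exact Real.exp_le_exp.mpr (neg_le_neg h1)
  have hsa : ∀ k, Φ.s ≤ a k := fun k => by
    rw [hs, show Real.exp (-x) = a 0 by simp [ha]]
    exact hmono k.zero_le
  have haI : ∀ k, a k ∈ (I k).carrier := fun k => by rw [hI]; rfl
  have ha1 : ∀ k, a k < 1 := fun k => ((I k).subset (haI k)).2
  have hlim : Tendsto a atTop (𝓝[<] 1) := by
    refine tendsto_nhdsWithin_iff.mpr ⟨?_, Eventually.of_forall ha1⟩
    have h1 : Tendsto (fun k : ℕ => x / (q : ℝ) ^ k) atTop (𝓝 0) :=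
      tendsto_const_nhds.div_atTop (tendsto_pow_atTop_atTop_of_one_lt hq1)
    have h2 := (Real.continuous_exp.tendsto _).comp h1.neg
    rwa [neg_zero, Real.exp_zero] at h2
  have hmul : ∀ k y, Real.exp (-(x / (q : ℝ) ^ k) + y) = a k * Real.exp y := fun k y =>
    Real.exp_add _ _
  -- The elements of `S k` are the logarithms of the admissible radii relative to that of the
  -- circle. The condition `y ≤ 0` keeps discs within the radius of the circle, as the product rule
  -- requires. The constant `L` is `log p`.
  have hgoal := eventually_neg_mem_of_concave
    (S := fun k => {y | y ≤ 0 ∧ E.IsTaylorBounded (I k) (Real.exp (-(x / (q : ℝ) ^ k) + y))})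
    hq hx (Real.log_pos hp1) (fun k y hy => hy.1) (fun k => ?_) (fun k y hy y' hy' => ?_)
    (fun M => ?_) (fun k y₀ hy₀ y₂ hy₂ => ?_) hε
  · filter_upwards [hgoal] with k hk
    rw [sub_eq_add_neg]
    exact hk.2
  · obtain ⟨β, hβ, hβI, h⟩ := NablaModule.exists_isTaylorBounded (p := p) E (I k)
    refine ⟨Real.log (β / a k), Real.log_nonpos (by have := ha0 k; positivity)
      ((div_le_one (ha0 k)).mpr (hβI _ (haI k))), ?_⟩
    rwa [hmul, Real.exp_log (div_pos hβ (ha0 k)), mul_div_cancel₀ _ (ha0 k).ne']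
  · exact ⟨hy'.trans hy.1, hy.2.mono (Real.exp_pos _).le (Real.exp_le_exp.mpr (by linarith))⟩
  · have h1 := ((tendsto_add_atTop_iff_nat 1).mpr hlim).eventually
      (eventually_gaussNorm_le_pow _ σ.reduction (q + (M + 1)))
    filter_upwards [h1] with k hk y hy y' hy1 hy2 hy3
    have hy0 : y' ≤ 0 := hy1.trans (div_nonpos_of_nonpos_of_nonneg hy.1 hq0.le)
    have hlt : a (k + 1) ^ (M + 1) < 1 := pow_lt_one₀ (ha0 _).le (ha1 _) M.succ_ne_zero
    have haM : a (k + 1) ^ (M + 1) ≤ a (k + 1) ^ M :=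
      pow_le_pow_of_le_one (ha0 _).le (ha1 _).le M.le_succ
    have hpos : 0 < a (k + 1) ^ q := pow_pos (ha0 _) _
    rw [pow_add] at hk
    refine ⟨hy0, ?_⟩
    rw [hmul]
    refine Φ.isTaylorBounded (J := I k) (b := Real.exp y) (hI (k + 1)) (hsa _) ?_ (Real.exp_pos _)
      (Real.exp_le_one_iff.mpr hy0) ?_ ?_ ?_ ?_ ?_
    · rw [← hqdef, haq, hI]
    · rw [← hqdef, ← Real.exp_nat_mul, Real.exp_le_exp]
      rwa [le_div_iff₀' hq0] at hy1
    · rw [inv_mul_le_iff₀ hp0]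
      calc Real.exp y' ≤ Real.exp (Real.log p + y) := Real.exp_le_exp.mpr (by linarith)
        _ = p * Real.exp y := by rw [Real.exp_add, Real.exp_log hp0]
    · exact hk.trans_lt (mul_lt_of_lt_one_right hpos hlt)
    · refine (mul_le_mul_of_nonneg_right hk (Real.exp_pos _).le).trans ?_
      rw [mul_assoc]
      refine mul_le_mul_of_nonneg_left ?_ hpos.le
      calc a (k + 1) ^ (M + 1) * Real.exp y' ≤ a (k + 1) ^ M * Real.exp y' :=
            mul_le_mul_of_nonneg_right haM (Real.exp_pos _).le
        _ = Real.exp (M * (-(x / (q : ℝ) ^ (k + 1))) + y') := by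
            rw [Real.exp_add, Real.exp_nat_mul]
        _ ≤ Real.exp y := Real.exp_le_exp.mpr (by linarith)
    · rw [← hqdef, haq, ← hmul]
      exact hy.2
  · have hmem : ∀ k, a k ∈ divValueGroup K := fun k =>
      (I k).least_mem _ (by rw [hI]; exact isLeast_singleton)
    have hrI : ∀ k, r ≤ a k := fun k => ((I k).le (haI k)).1
    -- Concavity needs a closed annulus that contains the circles `k`, `k + 1` and `k + 2`.
    set J : ClosedSub (ico r hr hr1) := ClosedSub.icc (hmem k) (hmem (k + 2)) (hrI k)
      (hmono (by omega)) (ha1 _)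
    have hIJ : ∀ i, k ≤ i → i ≤ k + 2 → (I i).toAlignedInterval ≤ J.toAlignedInterval := by
      intro i hi hi' z hz
      have hz' : z ∈ ({a i} : Set ℝ) := by
        have := hI i
        rw [← this]
        exact hz
      rw [Set.mem_singleton_iff.mp hz']
      exact ⟨hmono hi, hmono hi'⟩
    have haq2 : a (k + 2) ^ (q ^ 2) = a k := by
      rw [pow_two, pow_mul, haq (k + 1), haq]
    have hneg : (q * y₂ + y₀) / (q + 1) ≤ 0 :=
      div_nonpos_of_nonpos_of_nonneg (by nlinarith [hy₀.1, hy₂.1]) (by positivity)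
    refine ⟨hneg, ?_⟩
    refine NablaModule.isTaylorBounded_of_three_circles (q := q) (a := a (k + 2))
      (β₀ := Real.exp (-(x / (q : ℝ) ^ k) + y₀)) (β₂ := Real.exp (-(x / (q : ℝ) ^ (k + 2)) + y₂))
      (hIJ k le_rfl (by omega)) (hIJ (k + 1) (by omega) (by omega))
      (hIJ (k + 2) (by omega) le_rfl) ?_ ?_ (haI _)
      (Real.exp_pos _) (Real.exp_pos _) (Real.exp_pos _) ?_ ?_ hy₀.2 hy₂.2
    · rw [haq2]
      exact haI k
    · rw [haq, hI]
    · rw [← Real.exp_nat_mul, ← Real.exp_nat_mul, ← Real.exp_add]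
      congr 1
      push_cast
      field_simp
      ring
    · rw [haq (k + 1), hmul]
      exact mul_le_of_le_one_right (ha0 _).le (Real.exp_le_one_iff.mpr hneg)

theorem FrobeniusStructure.isOverconvergent (Φ : FrobeniusStructure σ E) (hn : 0 < n) :
    E.IsOverconvergent := by
  intro η hη0 hη1
  have hs0 : 0 < Φ.s := Φ.s_mem.1
  have hx : 0 < -Real.log Φ.s := neg_pos.mpr (Real.log_neg hs0 Φ.s_lt)
  set x := -Real.log Φ.s with hxdef
  have hq : 2 ≤ p ^ n := (Fact.out : p.Prime).two_le.trans (Nat.le_self_pow hn.ne' p)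
  have hq1 : (1 : ℝ) < (p ^ n : ℕ) := by exact_mod_cast hq
  have hq0 : (0 : ℝ) < (p ^ n : ℕ) := by linarith
  set a : ℕ → ℝ := fun k => Real.exp (-(x / ((p ^ n : ℕ) : ℝ) ^ k)) with ha
  have hs : Φ.s = Real.exp (-x) := by rw [hxdef, neg_neg, Real.exp_log hs0]
  have hmono : Monotone a := monotone_nat_of_le_succ fun k => by
    have h1 : x / ((p ^ n : ℕ) : ℝ) ^ (k + 1) ≤ x / ((p ^ n : ℕ) : ℝ) ^ k :=
      div_le_div_of_nonneg_left hx.le (by positivity) (pow_le_pow_right₀ hq1.le k.le_succ)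
    exact Real.exp_le_exp.mpr (neg_le_neg h1)
  have ha1 : ∀ k, a k < 1 := fun k => by
    have : 0 < x / ((p ^ n : ℕ) : ℝ) ^ k := by positivity
    exact Real.exp_lt_one_iff.mpr (by linarith)
  have hra : ∀ k, r ≤ a k := fun k => Φ.r_le.trans (by
    rw [hs, show Real.exp (-x) = a 0 by simp [ha]]
    exact hmono k.zero_le)
  have hmem : ∀ k, a k ∈ divValueGroup K := fun k => by
    obtain ⟨_, N, hN, y, hy⟩ := Φ.s_mem
    -- `a k` is a `q ^ k`-th root of `Φ.s`, and the `N`-th power of `Φ.s` is the absolute value of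
    -- `y`.
    refine ⟨Real.exp_pos _, (p ^ n) ^ k * N, by positivity, y, ?_⟩
    rw [pow_mul, ← hy, hs, ha, ← Real.exp_nat_mul]
    congr 2
    rw [Nat.cast_pow, mul_neg, mul_div_cancel₀ x (pow_pos hq0 k).ne']
  set I : ℕ → ClosedSub (ico r hr hr1) := fun k =>
    ClosedSub.icc (hmem k) (hmem k) (hra k) le_rfl (ha1 k) with hIdef
  have hI : ∀ k, (I k).carrier = {a k} := fun k => Set.Icc_self _
  have hlim0 : Tendsto (fun k : ℕ => x / ((p ^ n : ℕ) : ℝ) ^ k) atTop (𝓝 0) :=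
    tendsto_const_nhds.div_atTop (tendsto_pow_atTop_atTop_of_one_lt hq1)
  -- One half of `-log η` allows for the loss in the relative radius, the other half for `a k` being
  -- less than `1`. Together they give `η < β`.
  have hε : 0 < -Real.log η / 2 := by
    have := Real.log_neg hη0 hη1
    linarith
  obtain ⟨k, hk⟩ := eventually_atTop.mp
    ((Φ.eventually_isTaylorBounded hn hx I hI hs hε).and (hlim0.eventually_lt_const hε))
  set β : ℝ := Real.exp (-(x / ((p ^ n : ℕ) : ℝ) ^ k) - -Real.log η / 2) with hβ
  have hβ0 : 0 < β := Real.exp_pos _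
  have hηβ : η < β := by
    rw [hβ, ← Real.log_lt_iff_lt_exp hη0]
    have := (hk k le_rfl).2
    linarith
  have hβa : β ≤ a k := Real.exp_le_exp.mpr (by linarith)
  refine ⟨a k, hra k, ha1 k, fun L hL v => ?_⟩
  obtain ⟨d, hd⟩ := L.isCompact.exists_isGreatest L.nonempty
  have hd1 : d < 1 := (L.subset hd.1).2
  have hlim1 : Tendsto a atTop (𝓝 1) := by
    have h2 := (Real.continuous_exp.tendsto _).comp hlim0.neg
    rwa [neg_zero, Real.exp_zero] at h2
  -- The index `m` depends on `L`, but the radius `β` does not: the admissible radius on the circle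
  -- `a m` is no smaller than on `a k`.
  obtain ⟨m, hmd, hkm⟩ := ((hlim1.eventually_const_lt hd1).and (eventually_ge_atTop k)).exists
  set J : ClosedSub (ico r hr hr1) :=
    ClosedSub.icc (hmem k) (hmem m) (hra k) (hmono hkm) (ha1 m)
  have hLJ : L.toAlignedInterval ≤ J.toAlignedInterval := fun z hz =>
    ⟨hL z hz, (hd.2 hz).trans hmd.le⟩
  have hIJ : ∀ i, k ≤ i → i ≤ m → (I i).toAlignedInterval ≤ J.toAlignedInterval :=
    fun i hi hi' z hz => ⟨(hmono hi).trans hz.1, hz.2.trans (hmono hi')⟩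
  have hm' : E.IsTaylorBounded (I m) β :=
    (hk m hkm).1.mono hβ0.le (Real.exp_le_exp.mpr (by
      have : x / ((p ^ n : ℕ) : ℝ) ^ m ≤ x / ((p ^ n : ℕ) : ℝ) ^ k :=
        div_le_div_of_nonneg_left hx.le (by positivity) (pow_le_pow_right₀ hq1.le hkm)
      linarith))
  have hJ : E.IsTaylorBounded J β := NablaModule.isTaylorBounded_of_endpoints
    (a := a k) (b := a m) hβ0 (hIJ k le_rfl hkm) (hIJ m hkm le_rfl) ⟨le_rfl, le_rfl⟩
    ⟨le_rfl, le_rfl⟩ (fun z hz => ⟨hβa.trans hz.1, hz.1, hz.2⟩) (hk k le_rfl).1 hm'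
  have hLβ := hJ.res hβ0 hLJ fun z hz => hβa.trans (hL z hz)
  exact hLβ.isEtaNull hη0 hηβ v

end Frobenius

end PadicAnnuli

end

theorem lemmaL {K : Type*} [NormedField K] [IsUltrametricDist K] [CompleteSpace K] [CharZero K]
    {p : ℕ} [Fact p.Prime] [Fact (‖(p : K)‖ = (p : ℝ)⁻¹)]
    {r : ℝ} (hr : r ∈ PadicAnnuli.divValueGroup K) (hr1 : r < 1)
    (E : PadicAnnuli.NablaModule (PadicAnnuli.AlignedInterval.ico r hr hr1))
    {n : ℕ} (hn : 0 < n) (σK : PadicAnnuli.BaseFrobenius K p n)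
    (σ : PadicAnnuli.FrobeniusLift σK) (hF : Nonempty (PadicAnnuli.FrobeniusStructure σ E)) :
    E.IsOverconvergent := by
  obtain ⟨Φ⟩ := hF
  exact Φ.isOverconvergent hn
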